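/- Let $F$ be a field with $\mathrm{char}(F)\neq 2$ and let $K/F$ be a Galois extension whose group $G=\mathrm{Gal}(K/F)$ is isomorphic to $\mathbb{Z}/2\mathbb{Z}\oplus\mathbb{Z}/2\mathbb{Z}$. Let $\sigma_1,\sigma_2$ be any two generators of $G$, and put $H_0=\{1\}$, $H_1=\{1,\sigma_2\}$, $H_2=\{1,\sigma_1\}$, $H_3=\{1,\sigma_1\sigma_2\}$, $H_4=G$. Let $J(K)=K^\times/K^{\times 2}$, regarded as an $\mathbb{F}_2[G]$-module. For $n\geq 1$ let $\Omega^{-n}$ and $\Omega^{n}$ be the following $\mathbb{F}_2[G]$-modules of dimension $2n+1$ (written additively). - $\Omega^{-n}$ has $\mathbb{F}_2$-basis $\alpha_1,\dots,\alpha_n,\beta_1,\dots,\beta_{n+1}$, where $(1+\sigma_2)\alpha_i=\beta_i$ and $(1+\sigma_1)\alpha_i=\beta_{i+1}$ for $1\le i\le n$, and $G$ fixes every $\beta_j$. - $\Omega^{n}$ has $\mathbb{F}_2$-basis $\gamma_1,\dots,\gamma_{n+1},\delta_1,\dots,\delta_n$, where $(1+\sigma_1)\gamma_i=\delta_i$ and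 $(1+\sigma_2)\gamma_{i+1}=\delta_i$ for $1\le i\le n$, $(1+\sigma_2)\gamma_1=0=(1+\sigma_1)\gamma_{n+1}$, and $G$ fixes every $\delta_j$. Then, as an $\mathbb{F}_2[G]$-module, $$J(K)\simeq X\oplus Y_0\oplus Y_1\oplus Y_2\oplus Y_3\oplus Y_4\oplus Z_1\oplus Z_2,$$ where - $X$ is isomorphic to one of $\{0\}$, $\mathbb{F}_2$, $\mathbb{F}_2\oplus\mathbb{F}_2$, $\Omega^{-1}$, $\Omega^{-2}$, $\Omega^{-1}\oplus\Omega^{-1}$; - for each $i\in\{0,1,2,3,4\}$, $Y_i$ is a (possibly zero, possibly infinite) direct sum of modules isomorphic to $\mathbb{F}_2[G/H_i]$; - for each $i\in\{1,2\}$, $Z_i$ is a (possibly zero, possibly infinite) direct sum of modules isomorphic to $\Omega^{i}$. Moreover the nine modules $\mathbb{F}_2[G/H_i]$ ($0\le i\le 4$), $\Omega^{-1}$, $\Omega^{-2}$, $\Omega^{1}$, $\Omega^{2}$ are indecomposable. Hence $J(K)$ is a direct sum of indecomposable modules of at most $9$ isomorphism types. -/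

import Mathlib

open scoped MonoidAlgebra

noncomputable section

namespace BiquadraticModule

/-! ### The square class group `J(K) = Kˣ / Kˣ²` as a Galois module -/

section SquareClasses

variable (F K : Type*) [Field F] [Field K] [Algebra F K]

/-- `J(K) = Kˣ / Kˣ²`, written additively. -/
def J (K : Type*) [Field K] : Type _ :=
  Additive (Kˣ ⧸ (powMonoidHom 2 : Kˣ →* Kˣ).range)

instance (K : Type*) [Field K] : AddCommGroup (J K) :=
  inferInstanceAs (AddCommGroup (Additive (Kˣ ⧸ (powMonoidHom 2 : Kˣ →* Kˣ).range)))

theorem sq_eq_one_of_mod_squares (x : Kˣ ⧸ (powMonoidHom 2 : Kˣ →* Kˣ).range) : x ^ 2 = 1 := by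
  induction x using QuotientGroup.induction_on with | H u =>
  rw [← QuotientGroup.mk_pow]
  exact (QuotientGroup.eq_one_iff _).2 ⟨u, rfl⟩

theorem two_nsmul_J (x : J K) : 2 • x = 0 :=
  sq_eq_one_of_mod_squares K x

/-- The (unique) `𝔽₂`-vector space structure on `J(K)`. -/
instance : Module (ZMod 2) (J K) :=
  AddCommGroup.zmodModule (two_nsmul_J K)

/-- The action of `g ∈ Gal(K/F)` on `Kˣ / Kˣ²`, sending the class of `u` to the class of `g u`. -/
def galAct (g : K ≃ₐ[F] K) :
    (Kˣ ⧸ (powMonoidHom 2 : Kˣ →* Kˣ).range) →* (Kˣ ⧸ (powMonoidHom 2 : Kˣ →* Kˣ).range) :=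
  QuotientGroup.map _ _ (Units.map (g : K →* K)) (by
    rintro _ ⟨u, rfl⟩
    exact ⟨Units.map (g : K →* K) u, by simp⟩)

/-- `J(K)` as an `𝔽₂`-linear representation of `Gal(K/F)`. -/
def rhoJ : Representation (ZMod 2) (K ≃ₐ[F] K) (J K) where
  toFun g := AddMonoidHom.toZModLinearMap 2
    (show J K →+ J K from MonoidHom.toAdditive (galAct F K g))
  map_one' := by
    ext x
    induction x using Additive.rec with | ofMul x =>
    induction x using QuotientGroup.induction_on with | H u => rfl
  map_mul' g h := by
    ext x
    induction x using Additive.rec with | ofMul x =>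
    induction x using QuotientGroup.induction_on with | H u => rfl

/-- `J(K)` as an `𝔽₂[Gal(K/F)]`-module. -/
abbrev JMod : Type _ := (rhoJ F K).asModule

end SquareClasses

/-! ### Modules over `𝔽₂[G]`, where `G ≃ ℤ/2 ⊕ ℤ/2` is generated by `σ₁` and `σ₂` -/

section Klein

variable {G : Type*} [Group G] (e : G ≃* Multiplicative (ZMod 2 × ZMod 2))

/-- The first generator `σ₁`. -/
def sigma1 : G := e.symm (Multiplicative.ofAdd (1, 0))

/-- The second generator `σ₂`. -/
def sigma2 : G := e.symm (Multiplicative.ofAdd (0, 1))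

/-- The five subgroups of `G`:
`H₀ = 1`, `H₁ = {1, σ₂}`, `H₂ = {1, σ₁}`, `H₃ = {1, σ₁σ₂}`, `H₄ = G`. -/
def subgroupH : Fin 5 → Subgroup G :=
  ![⊥, Subgroup.zpowers (sigma2 e), Subgroup.zpowers (sigma1 e),
    Subgroup.zpowers (sigma1 e * sigma2 e), ⊤]

/-- The permutation module `𝔽₂[G/Hᵢ]`. -/
abbrev PermMod (i : Fin 5) : Type _ :=
  (Representation.ofMulAction (ZMod 2) G (G ⧸ subgroupH e i)).asModule

/-- The trivial one-dimensional module `𝔽₂`. -/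
abbrev TrivMod (G : Type*) [Group G] : Type :=
  (Representation.trivial (ZMod 2) G (ZMod 2)).asModule

/-- For linear maps `A, B : V → W`, the representation of `G` on `V × W` on which `1 + σ₁` acts as
`(v, w) ↦ (0, A v)` and `1 + σ₂` acts as `(v, w) ↦ (0, B v)`. -/
def twoStep {V W : Type*} [AddCommGroup V] [Module (ZMod 2) V] [AddCommGroup W]
    [Module (ZMod 2) W] (A B : V →ₗ[ZMod 2] W) : Representation (ZMod 2) G (V × W) where
  toFun g := LinearMap.id + (LinearMap.inr (ZMod 2) V W) ∘ₗ
    ((e g).toAdd.1 • A + (e g).toAdd.2 • B) ∘ₗ (LinearMap.fst (ZMod 2) V W)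
  map_one' := by ext <;> simp
  map_mul' g h := by
    refine LinearMap.ext fun x => Prod.ext ?_ ?_
    · simp
    · simp [add_smul]
      abel

/-- The map `eᵢ ↦ eᵢ` from `𝔽₂ⁿ` to `𝔽₂ⁿ⁺¹` (appending a zero). -/
def appendZero (n : ℕ) : (Fin n → ZMod 2) →ₗ[ZMod 2] (Fin (n + 1) → ZMod 2) where
  toFun v := Fin.snoc (α := fun _ => ZMod 2) v 0
  map_add' v w := by ext i; refine Fin.lastCases ?_ (fun j => ?_) i <;> simp
  map_smul' c v := by ext i; refine Fin.lastCases ?_ (fun j => ?_) i <;> simp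

/-- The map `eᵢ ↦ eᵢ₊₁` from `𝔽₂ⁿ` to `𝔽₂ⁿ⁺¹` (prepending a zero). -/
def prependZero (n : ℕ) : (Fin n → ZMod 2) →ₗ[ZMod 2] (Fin (n + 1) → ZMod 2) where
  toFun v := Fin.cons (α := fun _ => ZMod 2) 0 v
  map_add' v w := by ext i; refine Fin.cases ?_ (fun j => ?_) i <;> simp
  map_smul' c v := by ext i; refine Fin.cases ?_ (fun j => ?_) i <;> simp

/-- The map `𝔽₂ⁿ⁺¹ → 𝔽₂ⁿ` forgetting the last coordinate. -/
def dropLast (n : ℕ) : (Fin (n + 1) → ZMod 2) →ₗ[ZMod 2] (Fin n → ZMod 2) :=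
  LinearMap.funLeft (ZMod 2) (ZMod 2) Fin.castSucc

/-- The map `𝔽₂ⁿ⁺¹ → 𝔽₂ⁿ` forgetting the first coordinate. -/
def dropFirst (n : ℕ) : (Fin (n + 1) → ZMod 2) →ₗ[ZMod 2] (Fin n → ZMod 2) :=
  LinearMap.funLeft (ZMod 2) (ZMod 2) Fin.succ

/-- `Ω⁻ⁿ`, of dimension `2n + 1`: basis `α₁, …, αₙ, β₁, …, βₙ₊₁` with
`(1 + σ₂) αᵢ = βᵢ`, `(1 + σ₁) αᵢ = βᵢ₊₁`, and all `βⱼ` fixed by `G`. -/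
abbrev OmegaNeg (n : ℕ) : Type := (twoStep e (prependZero n) (appendZero n)).asModule

/-- `Ωⁿ`, of dimension `2n + 1`: basis `γ₁, …, γₙ₊₁, δ₁, …, δₙ` with
`(1 + σ₁) γᵢ = δᵢ` for `i ≤ n`, `(1 + σ₁) γₙ₊₁ = 0`, `(1 + σ₂) γ₁ = 0`,
`(1 + σ₂) γᵢ₊₁ = δᵢ` for `i ≤ n`, and all `δⱼ` fixed by `G`. -/
abbrev OmegaPos (n : ℕ) : Type := (twoStep e (dropLast n) (dropFirst n)).asModule

end Klein

/-! ### General module theory -/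

section Modules

variable (R : Type*) [Semiring R]

/-- `M` is a direct sum of (arbitrarily many, possibly zero) copies of `N`. -/
def IsSumOfCopies.{v} (N : Type*) [AddCommMonoid N] [Module R N]
    (M : Type v) [AddCommMonoid M] [Module R M] : Prop :=
  ∃ ι : Type v, Nonempty (M ≃ₗ[R] (ι →₀ N))

/-- `M` is indecomposable: it is nonzero and is not a direct sum of two nonzero submodules. -/
def IsIndecomposable (M : Type*) [AddCommMonoid M] [Module R M] : Prop :=
  Nontrivial M ∧ ∀ A B : Submodule R M, IsCompl A B → A = ⊥ ∨ B = ⊥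

end Modules

end BiquadraticModule

end

/-! Write a₁ = 1 + σ₁ and a₂ = 1 + σ₂. Then 𝔽₂[G] is generated by commuting a₁, a₂ of square zero, a
module is an 𝔽₂-space with two such operators, and a nonzero submodule always contains nonzero fixed
elements. Hence injectivity and independence of submodules need only be tested on fixed elements
(`injective_of_fixed`, `eq_zero_of_fixed`), and a sum of copies of a model module can be built by
prescribing its fixed part (`exists_copies`).

Let U be the image of Fˣ in J(K). Three facts from field theory drive the proof. If the class of u
is fixed by an involution g, so that g u = u t², then t · g t = ±1 gives a linear sign. By Hilbert
90 a G-fixed class lies in U exactly when its signs for σ₂, σ₁ and σ₁σ₂ vanish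
(`mem_baseClasses_iff`). If a₁a₂m = 0, the signs of a₁m and a₂m depend on only two bits
(`sign_relations`). If a₁m and a₂m both lie in U, they agree up to norms from the intermediate
fields, including the class of -1 (`exists_sub_norm`).

The rest is linear algebra. The two bits have an image of dimension at most two on ker(a₁a₂), and
lifting that image gives X (`exists_exceptional`). What remains of ker(a₁a₂) maps into U under a₁
and a₂. Inside U sit the subspaces N₁, N₂, N₃ of elements of the form (a₁m, a₂m) = (u, 0), (0, u),
(u, u); any two meet in the triple intersection. Successive complements in this configuration are
the fixed parts of the summands: im(a₁a₂) gives free modules, its complement in N₁ ∩ N₂ gives Ω¹, a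
complement of N₁ ∩ N₂ in N₃ ∩ (N₁ + N₂) gives Ω², what is left in each Nᵢ gives 𝔽₂[G/Hᵢ], and the
leftover fixed classes give trivial modules (`exists_decomposition`). -/

noncomputable section

namespace BiquadraticModule

/-! ### The group algebra of the Klein four-group and reduction to fixed elements. -/

section Klein
variable {G : Type*} [Group G] (e : G ≃* Multiplicative (ZMod 2 × ZMod 2))

/-- The element `1 + σ₁` of the group algebra. -/
def aug1 : (ZMod 2)[G] := 1 + MonoidAlgebra.of (ZMod 2) G (sigma1 e)

/-- The element `1 + σ₂` of the group algebra. -/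
def aug2 : (ZMod 2)[G] := 1 + MonoidAlgebra.of (ZMod 2) G (sigma2 e)

theorem sigma1_mul_self : sigma1 e * sigma1 e = 1 := by
  rw [sigma1, ← map_mul, ← map_one e.symm]; congr 1

theorem sigma2_mul_self : sigma2 e * sigma2 e = 1 := by
  rw [sigma2, ← map_mul, ← map_one e.symm]; congr 1

theorem sigma1_mul_sigma2 : sigma2 e * sigma1 e = sigma1 e * sigma2 e := by
  exact e.injective (by rw [map_mul, map_mul, mul_comm])

theorem eq_of_klein (g : G) :
    g = 1 ∨ g = sigma1 e ∨ g = sigma2 e ∨ g = sigma1 e * sigma2 e := by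
  have h : ∀ a : ZMod 2 × ZMod 2, a = 0 ∨ a = (1, 0) ∨ a = (0, 1) ∨ a = (1, 0) + (0, 1) := by
    decide
  rcases h (e g).toAdd with h | h | h | h
  · left; apply e.injective; rw [map_one]; exact h
  · right; left; apply e.injective; rw [sigma1, e.apply_symm_apply]; exact h
  · right; right; left; apply e.injective; rw [sigma2, e.apply_symm_apply]; exact h
  · right; right; right; apply e.injective
    rw [sigma1, sigma2, map_mul, e.apply_symm_apply, e.apply_symm_apply]; exact h

theorem add_self_groupAlgebra (r : (ZMod 2)[G]) : r + r = 0 := ZModModule.add_self r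

theorem aug1_mul_self : aug1 e * aug1 e = 0 := by
  have h := add_self_groupAlgebra (G := G)
  simp only [aug1, add_mul, mul_add, one_mul, mul_one, ← map_mul, sigma1_mul_self, map_one]
  rw [add_comm (MonoidAlgebra.of (ZMod 2) G (sigma1 e)) 1]
  exact h _

theorem aug2_mul_self : aug2 e * aug2 e = 0 := by
  have h := add_self_groupAlgebra (G := G)
  simp only [aug2, add_mul, mul_add, one_mul, mul_one, ← map_mul, sigma2_mul_self, map_one]
  rw [add_comm (MonoidAlgebra.of (ZMod 2) G (sigma2 e)) 1]
  exact h _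

theorem aug2_mul_aug1 : aug2 e * aug1 e = aug1 e * aug2 e := by
  simp only [aug1, aug2, add_mul, mul_add, one_mul, mul_one, ← map_mul, sigma1_mul_sigma2]
  abel

theorem of_sigma1 : MonoidAlgebra.of (ZMod 2) G (sigma1 e) = 1 + aug1 e := by
  rw [aug1, ← add_assoc, add_self_groupAlgebra, zero_add]

theorem of_sigma2 : MonoidAlgebra.of (ZMod 2) G (sigma2 e) = 1 + aug2 e := by
  rw [aug2, ← add_assoc, add_self_groupAlgebra, zero_add]

section Mod
variable {M N : Type*} [AddCommGroup M] [Module (ZMod 2)[G] M]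
  [AddCommGroup N] [Module (ZMod 2)[G] N]

@[simp] theorem aug1_aug1 (m : M) : aug1 e • aug1 e • m = 0 := by
  rw [← mul_smul, aug1_mul_self, zero_smul]

@[simp] theorem aug2_aug2 (m : M) : aug2 e • aug2 e • m = 0 := by
  rw [← mul_smul, aug2_mul_self, zero_smul]

theorem aug2_aug1 (m : M) : aug2 e • aug1 e • m = aug1 e • aug2 e • m := by
  rw [← mul_smul, aug2_mul_aug1, mul_smul]

/-- Additive maps commuting with `1 + σ₁` and `1 + σ₂` are linear over the group algebra. -/
def homOfAug (f : M →+ N) (h1 : ∀ m, f (aug1 e • m) = aug1 e • f m)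
    (h2 : ∀ m, f (aug2 e • m) = aug2 e • f m) : M →ₗ[(ZMod 2)[G]] N where
  __ := f
  map_smul' r m := by
    change f (r • m) = r • f m
    have key : ∀ g m, f (MonoidAlgebra.of (ZMod 2) G g • m)
        = MonoidAlgebra.of (ZMod 2) G g • f m := by
      intro g m
      have k1 : ∀ m, f (MonoidAlgebra.of (ZMod 2) G (sigma1 e) • m)
          = MonoidAlgebra.of (ZMod 2) G (sigma1 e) • f m := by
        intro m; rw [of_sigma1, add_smul, add_smul, map_add, h1, one_smul, one_smul]
      have k2 : ∀ m, f (MonoidAlgebra.of (ZMod 2) G (sigma2 e) • m)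
          = MonoidAlgebra.of (ZMod 2) G (sigma2 e) • f m := by
        intro m; rw [of_sigma2, add_smul, add_smul, map_add, h2, one_smul, one_smul]
      rcases eq_of_klein e g with rfl | rfl | rfl | rfl
      · simp only [map_one, one_smul]
      · exact k1 m
      · exact k2 m
      · rw [map_mul, mul_smul, k1, k2, mul_smul]
    induction r using MonoidAlgebra.induction_on with
    | of g => exact key g m
    | add a b ha hb => rw [add_smul, add_smul, map_add, ha, hb]
    | smul c a ha =>
      obtain rfl | rfl : c = 0 ∨ c = 1 := by revert c; decide
      · simp
      · rw [one_smul]; exact ha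

/-- If the fixed elements of a family of submodules satisfy no relation, then neither do the
submodules. -/
theorem eq_zero_of_fixed {ι : Type*} [Fintype ι] (S : ι → Submodule (ZMod 2)[G] M)
    (h : ∀ f : ι → M, (∀ i, f i ∈ S i) → (∀ i, aug1 e • f i = 0) → (∀ i, aug2 e • f i = 0) →
      ∑ i, f i = 0 → f = 0) (f : ι → M) (hf : ∀ i, f i ∈ S i) (hs : ∑ i, f i = 0) : f = 0 := by
  have red : ∀ r : (ZMod 2)[G], (∀ i, aug1 e • r • f i = 0) → (∀ i, aug2 e • r • f i = 0) →
      ∀ i, r • f i = 0 := fun r h1 h2 i =>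
    congrFun (h (fun i => r • f i) (fun i => (S i).smul_mem r (hf i)) h1 h2
      (by rw [← Finset.smul_sum, hs, smul_zero])) i
  have h12 : ∀ i, aug1 e • aug2 e • f i = 0 := by
    have := red (aug1 e * aug2 e) (fun i => by rw [mul_smul, aug1_aug1])
      (fun i => by rw [mul_smul, aug2_aug1, aug2_aug2, smul_zero])
    simpa only [mul_smul] using this
  have h1 := red (aug1 e) (fun i => aug1_aug1 e _) (fun i => by rw [aug2_aug1, h12])
  have h2 := red (aug2 e) h12 (fun i => aug2_aug2 e _)
  exact h f hf h1 h2 hs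

/-- A linear map which is injective on fixed elements is injective. -/
theorem injective_of_fixed (f : M →ₗ[(ZMod 2)[G]] N)
    (h : ∀ m, aug1 e • m = 0 → aug2 e • m = 0 → f m = 0 → m = 0) : Function.Injective f := by
  rw [injective_iff_map_eq_zero]
  intro m hm
  have hr : ∀ r : (ZMod 2)[G], f (r • m) = 0 := fun r => by rw [map_smul, hm, smul_zero]
  have h12 : aug1 e • aug2 e • m = 0 := by
    rw [← mul_smul]
    refine h _ ?_ ?_ (hr _) <;> rw [mul_smul]
    · simp
    · rw [aug2_aug1]; simp
  exact h m (h _ (by simp) (by rw [aug2_aug1, h12]) (hr _)) (h _ h12 (by simp) (hr _)) hm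

end Mod

/-- Suppose that the fixed elements of `N` are spanned by `b`, and that linear maps `ψ j : E → M`
with independent images are such that each `b j ↦ ψ j v` is induced by a homomorphism `N → M`. Then
`M` contains a sum of copies of `N` whose fixed elements are the sums of elements `ψ j v`. -/
theorem exists_copies {M N κ : Type*} [AddCommGroup M] [Module (ZMod 2)[G] M]
    [Module (ZMod 2) M] [IsScalarTower (ZMod 2) (ZMod 2)[G] M]
    [AddCommGroup N] [Module (ZMod 2)[G] N]
    [Module (ZMod 2) N] [IsScalarTower (ZMod 2) (ZMod 2)[G] N] [Fintype κ] (b : κ → N)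
    (hb : ∀ n : N, aug1 e • n = 0 → aug2 e • n = 0 → ∃ c : κ → ZMod 2, n = ∑ j, c j • b j)
    (E : Submodule (ZMod 2) M) (ψ : κ → E →ₗ[ZMod 2] M)
    (hψ : ∀ v : E, ∃ φ : N →ₗ[(ZMod 2)[G]] M, ∀ j, φ (b j) = ψ j v)
    (hinj : ∀ v : κ → E, ∑ j, ψ j (v j) = 0 → v = 0) :
    ∃ Y : Submodule (ZMod 2)[G] M, IsSumOfCopies (ZMod 2)[G] N Y ∧
      (∀ v : E, ∃ φ : N →ₗ[(ZMod 2)[G]] M, (∀ n, φ n ∈ Y) ∧ ∀ j, φ (b j) = ψ j v) ∧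
      ∀ m ∈ Y, aug1 e • m = 0 → aug2 e • m = 0 → ∃ v : κ → E, m = ∑ j, ψ j (v j) := by
  classical
  let B := Module.Basis.ofVectorSpace (ZMod 2) E
  let ι := Module.Basis.ofVectorSpaceIndex (ZMod 2) E
  choose φ hφ using fun i : ι => hψ (B i)
  let Φ : (ι →₀ N) →ₗ[(ZMod 2)[G]] M := Finsupp.lsum (ZMod 2) φ
  have hfix : ∀ z : ι →₀ N, aug1 e • z = 0 → aug2 e • z = 0 →
      ∃ c : κ → (ι →₀ ZMod 2), (∀ i, z i = ∑ j, c j i • b j) ∧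
        Φ z = ∑ j, ψ j (B.repr.symm (c j)) := by
    intro z h1 h2
    -- The `b j` need not be independent, so coefficients are forced to vanish where `z` does; this
    -- keeps their support finite.
    have hz : ∀ i, ∃ c : κ → ZMod 2, z i = ∑ j, c j • b j ∧ (z i = 0 → c = 0) := by
      intro i
      by_cases h0 : z i = 0
      · exact ⟨0, by simp [h0], fun _ => rfl⟩
      · obtain ⟨c, hc⟩ := hb (z i) (by rw [← Finsupp.smul_apply, h1]; rfl)
          (by rw [← Finsupp.smul_apply, h2]; rfl)
        exact ⟨c, hc, fun h => absurd h h0⟩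
    choose c hc hc0 using hz
    let c' : κ → (ι →₀ ZMod 2) := fun j => Finsupp.onFinset z.support (fun i => c i j) (by
      intro i hi
      rw [Finsupp.mem_support_iff]
      intro h
      exact hi (by rw [hc0 i h]; rfl))
    refine ⟨c', fun i => hc i, ?_⟩
    have e1 : Φ z = ∑ i ∈ z.support, φ i (z i) := by
      simp [Φ, Finsupp.sum]
    have e2 : ∀ j, B.repr.symm (c' j) = ∑ i ∈ z.support, c i j • B i := by
      intro j
      rw [Module.Basis.repr_symm_apply, Finsupp.linearCombination_apply]
      exact Finsupp.onFinset_sum _ (by simp)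
    rw [e1]
    simp only [e2, map_sum, map_smul]
    rw [Finset.sum_comm]
    refine Finset.sum_congr rfl fun i _ => ?_
    rw [hc i, map_sum]
    refine Finset.sum_congr rfl fun j _ => ?_
    rw [LinearMap.map_smul_of_tower, hφ]
  have hΦ : Function.Injective Φ := by
    refine injective_of_fixed e Φ fun z h1 h2 h0 => ?_
    obtain ⟨c, hc, hs⟩ := hfix z h1 h2
    have := hinj _ (hs.symm.trans h0)
    have hc0 : ∀ j, c j = 0 := fun j => by
      exact B.repr.symm.map_eq_zero_iff.1 (congrFun this j)
    ext i
    rw [hc i]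
    simp [hc0]
  refine ⟨LinearMap.range Φ, ⟨ι, ⟨(LinearEquiv.ofInjective Φ hΦ).symm⟩⟩, ?_, ?_⟩
  · intro v
    refine ⟨Φ ∘ₗ ∑ i ∈ (B.repr v).support, (B.repr v i) • Finsupp.lsingle i,
      fun n => LinearMap.mem_range_self _ _, fun j => ?_⟩
    have : ψ j v = ψ j (∑ i ∈ (B.repr v).support, B.repr v i • B i) := by
      congr 1
      conv_lhs => rw [← B.linearCombination_repr v, Finsupp.linearCombination_apply]
      rfl
    rw [this]
    simp only [LinearMap.comp_apply, LinearMap.sum_apply, map_sum, LinearMap.smul_apply, map_smul,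
      LinearMap.map_smul_of_tower]
    refine Finset.sum_congr rfl fun i _ => ?_
    rw [← hφ]
    simp [Φ]
  · rintro _ ⟨z, rfl⟩ h1 h2
    have g1 : aug1 e • z = 0 := hΦ (by rw [map_smul, h1, map_zero])
    have g2 : aug2 e • z = 0 := hΦ (by rw [map_smul, h2, map_zero])
    obtain ⟨c, -, hs⟩ := hfix z g1 g2
    exact ⟨_, hs⟩

end Klein

/-! ### Concrete models: two-step modules and permutation modules. -/

section Models
variable {G : Type*} [Group G] (e : G ≃* Multiplicative (ZMod 2 × ZMod 2))

section TwoStep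
variable {V W : Type*} [AddCommGroup V] [Module (ZMod 2) V] [AddCommGroup W]
    [Module (ZMod 2) W] (A B : V →ₗ[ZMod 2] W)

theorem of_smul_asModule {V : Type*} [AddCommGroup V] [Module (ZMod 2) V]
    (ρ : Representation (ZMod 2) G V) (g : G) (v : V) :
    (MonoidAlgebra.of (ZMod 2) G g • (ρ.asModuleEquiv.symm v) : ρ.asModule)
      = ρ.asModuleEquiv.symm (ρ g v) := by
  rw [Representation.asModuleEquiv_symm_map_rho]

/-- The element `(v, w)` of the module defined by `twoStep`. -/
def tsMk (v : V) (w : W) : (twoStep e A B).asModule := (twoStep e A B).asModuleEquiv.symm (v, w)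

theorem exists_tsMk (m : (twoStep e A B).asModule) : ∃ v w, m = tsMk e A B v w :=
  ⟨((twoStep e A B).asModuleEquiv m).1, ((twoStep e A B).asModuleEquiv m).2, rfl⟩

theorem tsMk_add (v v' : V) (w w' : W) :
    tsMk e A B v w + tsMk e A B v' w' = tsMk e A B (v + v') (w + w') := rfl

theorem tsMk_smul (c : ZMod 2) (v : V) (w : W) :
    c • tsMk e A B v w = tsMk e A B (c • v) (c • w) := rfl

theorem tsMk_zero : tsMk e A B 0 0 = 0 := rfl

theorem tsMk_inj {v v' : V} {w w' : W} :
    tsMk e A B v w = tsMk e A B v' w' ↔ v = v' ∧ w = w' := Prod.ext_iff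

theorem tsMk_eq_zero {v : V} {w : W} : tsMk e A B v w = 0 ↔ v = 0 ∧ w = 0 := Prod.ext_iff

@[simp] theorem aug1_tsMk (v : V) (w : W) : aug1 e • tsMk e A B v w = tsMk e A B 0 (A v) := by
  rw [aug1, add_smul, one_smul, tsMk, of_smul_asModule, ← map_add]
  change tsMk e A B _ _ = _
  rw [tsMk_inj]
  simp [twoStep, sigma1, ZModModule.add_self, ← add_assoc]

@[simp] theorem aug2_tsMk (v : V) (w : W) : aug2 e • tsMk e A B v w = tsMk e A B 0 (B v) := by
  rw [aug2, add_smul, one_smul, tsMk, of_smul_asModule, ← map_add]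
  change tsMk e A B _ _ = _
  rw [tsMk_inj]
  simp [twoStep, sigma2, ZModModule.add_self, ← add_assoc]

variable {M : Type*} [AddCommGroup M] [Module (ZMod 2)[G] M] [Module (ZMod 2) M]

/-- Homomorphisms out of the module defined by `twoStep`. -/
def tsHom (f : V →ₗ[ZMod 2] M) (g : W →ₗ[ZMod 2] M)
    (h1 : ∀ v, aug1 e • f v = g (A v)) (h2 : ∀ v, aug2 e • f v = g (B v))
    (k1 : ∀ w, aug1 e • g w = 0) (k2 : ∀ w, aug2 e • g w = 0) :
    (twoStep e A B).asModule →ₗ[(ZMod 2)[G]] M :=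
  homOfAug e
    ((f.coprod g).toAddMonoidHom.comp (twoStep e A B).asModuleEquiv.toLinearMap.toAddMonoidHom)
    (by
      intro m
      obtain ⟨v, w, rfl⟩ := exists_tsMk e A B m
      rw [aug1_tsMk]
      change f 0 + g (A v) = aug1 e • (f v + g w)
      simp [h1, k1])
    (by
      intro m
      obtain ⟨v, w, rfl⟩ := exists_tsMk e A B m
      rw [aug2_tsMk]
      change f 0 + g (B v) = aug2 e • (f v + g w)
      simp [h2, k2])

@[simp] theorem tsHom_tsMk (f : V →ₗ[ZMod 2] M) (g : W →ₗ[ZMod 2] M)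
    (h1 : ∀ v, aug1 e • f v = g (A v)) (h2 : ∀ v, aug2 e • f v = g (B v))
    (k1 : ∀ w, aug1 e • g w = 0) (k2 : ∀ w, aug2 e • g w = 0) (v : V) (w : W) :
    tsHom e A B f g h1 h2 k1 k2 (tsMk e A B v w) = f v + g w := rfl

variable {e A B} in
theorem tsMk_mem_of_fixed (h : ∀ v, A v = 0 → B v = 0 → v = 0) (m : (twoStep e A B).asModule)
    (h1 : aug1 e • m = 0) (h2 : aug2 e • m = 0) : ∃ w, m = tsMk e A B 0 w := by
  obtain ⟨v, w, rfl⟩ := exists_tsMk e A B m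
  rw [aug1_tsMk, tsMk_eq_zero] at h1
  rw [aug2_tsMk, tsMk_eq_zero] at h2
  exact ⟨w, by rw [h v h1.2 h2.2]⟩

end TwoStep

section Perm

variable (i : Fin 5)

/-- The generator of the permutation module. -/
def permGen : PermMod e i :=
  (Representation.ofMulAction (ZMod 2) G (G ⧸ subgroupH e i)).asModuleEquiv.symm
    (MonoidAlgebra.single ((1 : G) : G ⧸ subgroupH e i) 1)

/-- G acts transitively on the cosets, so a fixed element has constant coefficients, and over 𝔽₂
only one nonzero constant exists. -/
theorem permMod_fixed (b : PermMod e i) (hb : b ≠ 0) (hb1 : aug1 e • b = 0)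
    (hb2 : aug2 e • b = 0) (n : PermMod e i)
    (h1 : aug1 e • n = 0) (h2 : aug2 e • n = 0) : n = 0 ∨ n = b := by
  let co : PermMod e i → (G ⧸ subgroupH e i) → ZMod 2 := fun n q => MonoidAlgebra.coeff
    ((Representation.ofMulAction (ZMod 2) G (G ⧸ subgroupH e i)).asModuleEquiv n) q
  have hinj : ∀ n n' : PermMod e i, (∀ q, co n q = co n' q) → n = n' := by
    intro n n' h
    exact MonoidAlgebra.ext (Finsupp.ext h)
  have hsm : ∀ (n : PermMod e i) (g : G), MonoidAlgebra.of (ZMod 2) G g • n = n →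
      ∀ q, co n (g⁻¹ • q) = co n q := by
    intro n g h q
    conv_rhs => rw [← h]
    simp only [co, Representation.asModuleEquiv_map_smul, Representation.asAlgebraHom_of]
    rw [Representation.coeff_ofMulAction]
  have hfix : ∀ n : PermMod e i, aug1 e • n = 0 → aug2 e • n = 0 →
      ∀ q, co n q = co n ((1 : G) : G ⧸ subgroupH e i) := by
    intro n h1 h2 q
    have k1 : MonoidAlgebra.of (ZMod 2) G (sigma1 e) • n = n := by
      rw [of_sigma1, add_smul, h1, one_smul, add_zero]
    have k2 : MonoidAlgebra.of (ZMod 2) G (sigma2 e) • n = n := by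
      rw [of_sigma2, add_smul, h2, one_smul, add_zero]
    induction q using QuotientGroup.induction_on with | H g =>
    have k : ∀ g, MonoidAlgebra.of (ZMod 2) G g • n = n := by
      intro g
      rcases eq_of_klein e g with rfl | rfl | rfl | rfl
      · rw [map_one, one_smul]
      · exact k1
      · exact k2
      · rw [map_mul, mul_smul, k2, k1]
    rw [← hsm n g (k g)]
    congr 1
    rw [MulAction.Quotient.smul_coe, smul_eq_mul, inv_mul_cancel]
  have two : ∀ a : ZMod 2, a = 0 ∨ a = 1 := by decide
  have hb1' : co b ((1 : G) : G ⧸ subgroupH e i) = 1 := by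
    refine (two _).resolve_left fun h => hb (hinj _ _ fun q => ?_)
    rw [hfix b hb1 hb2, h]; rfl
  rcases two (co n ((1 : G) : G ⧸ subgroupH e i)) with h | h
  · left; refine hinj _ _ fun q => ?_
    rw [hfix n h1 h2, h]; rfl
  · right; refine hinj _ _ fun q => ?_
    rw [hfix n h1 h2, h, hfix b hb1 hb2, hb1']

theorem of_permGen (g : G) : MonoidAlgebra.of (ZMod 2) G g • permGen e i =
    (Representation.ofMulAction (ZMod 2) G (G ⧸ subgroupH e i)).asModuleEquiv.symm
    (MonoidAlgebra.single (g : G ⧸ subgroupH e i) 1) := by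
  rw [permGen, of_smul_asModule, Representation.ofMulAction_single, MulAction.Quotient.smul_coe,
    smul_eq_mul, mul_one]

theorem of_permGen_of_mem (g : G) (hg : g ∈ subgroupH e i) :
    MonoidAlgebra.of (ZMod 2) G g • permGen e i = permGen e i := by
  rw [of_permGen, permGen]
  congr 2
  exact QuotientGroup.eq.2 (by simpa using hg)

theorem of_permGen_ne (g : G) (hg : g ∉ subgroupH e i) :
    MonoidAlgebra.of (ZMod 2) G g • permGen e i ≠ permGen e i := by
  rw [of_permGen, permGen]
  intro h
  have h' := MonoidAlgebra.single_left_injective (one_ne_zero (α := ZMod 2)) h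
  exact hg (by simpa using QuotientGroup.eq.1 h')

/-- Homomorphisms out of a permutation module. -/
theorem exists_permHom {M : Type*} [AddCommGroup M] [Module (ZMod 2)[G] M] [Module (ZMod 2) M]
    [IsScalarTower (ZMod 2) (ZMod 2)[G] M] (m : M)
    (hm : ∀ g ∈ subgroupH e i, MonoidAlgebra.of (ZMod 2) G g • m = m) :
    ∃ φ : PermMod e i →ₗ[(ZMod 2)[G]] M, φ (permGen e i) = m := by
  let a : (G ⧸ subgroupH e i) → M := Quotient.lift
    (fun g : G => MonoidAlgebra.of (ZMod 2) G g • m) (by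
      intro g h hgh
      have := hm _ (QuotientGroup.leftRel_apply.1 hgh)
      change MonoidAlgebra.of (ZMod 2) G g • m = MonoidAlgebra.of (ZMod 2) G h • m
      conv_lhs => rw [← this]
      rw [← mul_smul, ← map_mul, mul_inv_cancel_left])
  let f : (ZMod 2)[G ⧸ subgroupH e i] →ₗ[ZMod 2] M :=
    (Finsupp.linearCombination (ZMod 2) a) ∘ₗ (MonoidAlgebra.coeffLinearEquiv (ZMod 2)).toLinearMap
  have hf : ∀ q c, f (MonoidAlgebra.single q c) = c • a q := by
    intro q c
    simp [f]
  have ha : ∀ (g : G) q, a (g • q) = MonoidAlgebra.of (ZMod 2) G g • a q := by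
    intro g q
    induction q using QuotientGroup.induction_on with | H h =>
    change MonoidAlgebra.of (ZMod 2) G (g * h) • m = _ • MonoidAlgebra.of (ZMod 2) G h • m
    rw [← mul_smul, map_mul]
  have key : ∀ (g : G) (n : (ZMod 2)[G ⧸ subgroupH e i]),
      f (Representation.ofMulAction (ZMod 2) G (G ⧸ subgroupH e i) g n)
        = MonoidAlgebra.of (ZMod 2) G g • f n := by
    intro g n
    induction n using MonoidAlgebra.induction_linear with
    | zero => simp
    | add x y hx hy => rw [map_add, map_add, map_add, hx, hy, smul_add]
    | single q c => rw [Representation.ofMulAction_single, hf, hf, ha, smul_comm]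
  let F : PermMod e i →+ M := f.toAddMonoidHom.comp (Representation.asModuleEquiv
    (Representation.ofMulAction (ZMod 2) G (G ⧸ subgroupH e i))).toLinearMap.toAddMonoidHom
  have hF : ∀ (g : G) (n : PermMod e i), F (MonoidAlgebra.of (ZMod 2) G g • n)
      = MonoidAlgebra.of (ZMod 2) G g • F n := by
    intro g n
    refine Eq.trans ?_ (key g _)
    change f (Representation.asModuleEquiv _ _) = _
    rw [Representation.asModuleEquiv_map_smul, Representation.asAlgebraHom_of]
    rfl
  refine ⟨homOfAug e F ?_ ?_, ?_⟩
  · intro n; rw [aug1, add_smul, add_smul, map_add, hF, one_smul, one_smul]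
  · intro n; rw [aug2, add_smul, add_smul, map_add, hF, one_smul, one_smul]
  · change f (MonoidAlgebra.single _ _) = m
    rw [hf, one_smul]
    change MonoidAlgebra.of (ZMod 2) G 1 • m = m
    rw [map_one, one_smul]

end Perm
end Models

/-! ### Sums of copies of the model modules inside a given module. -/

section Summands
variable {G : Type*} [Group G] (e : G ≃* Multiplicative (ZMod 2 × ZMod 2))

section Perm

theorem mem_zpowers_of_mul_self {s g : G} (hs : s * s = 1) (hg : g ∈ Subgroup.zpowers s) :
    g = 1 ∨ g = s := by
  obtain ⟨k, rfl⟩ := Subgroup.mem_zpowers_iff.1 hg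
  obtain ⟨j, rfl | rfl⟩ := Int.even_or_odd' k
  · left; rw [zpow_mul, zpow_two, hs, one_zpow]
  · right; rw [zpow_add, zpow_mul, zpow_two, hs, one_zpow, zpow_one, one_mul]

theorem sigma1_ne_one : sigma1 e ≠ 1 := by
  rw [sigma1, Ne, ← e.injective.eq_iff, e.apply_symm_apply, map_one]; decide

theorem sigma2_ne_one : sigma2 e ≠ 1 := by
  rw [sigma2, Ne, ← e.injective.eq_iff, e.apply_symm_apply, map_one]; decide

theorem sigma1_ne_sigma2 : sigma1 e ≠ sigma2 e := by
  rw [sigma1, sigma2, Ne, e.symm.injective.eq_iff]; decide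

theorem sigma12_mul_self : (sigma1 e * sigma2 e) * (sigma1 e * sigma2 e) = 1 := by
  rw [mul_assoc, ← mul_assoc (sigma2 e), sigma1_mul_sigma2, mul_assoc, sigma2_mul_self, mul_one,
    sigma1_mul_self]

theorem sigma12_ne_one : sigma1 e * sigma2 e ≠ 1 := by
  intro h
  apply sigma1_ne_sigma2 e
  rw [← mul_left_inj (sigma2 e), h, sigma2_mul_self]

section Stab
variable {M : Type*} [AddCommGroup M] [Module (ZMod 2)[G] M]

theorem add_self_of_groupAlgebra (G : Type*) [Group G] {M : Type*} [AddCommGroup M]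
    [Module (ZMod 2)[G] M] (m : M) : m + m = 0 := by
  have := add_self_groupAlgebra (1 : (ZMod 2)[G])
  rw [← one_smul (ZMod 2)[G] m, ← add_smul, this, zero_smul]

theorem aug1_smul_mul_smul (m : M) : aug1 e • (aug1 e * aug2 e) • m = 0 := by
  rw [mul_smul, aug1_aug1]

theorem aug2_smul_mul_smul (m : M) : aug2 e • (aug1 e * aug2 e) • m = 0 := by
  rw [mul_smul, aug2_aug1, aug2_aug2, smul_zero]

theorem of_sigma1_smul_iff (m : M) :
    MonoidAlgebra.of (ZMod 2) G (sigma1 e) • m = m ↔ aug1 e • m = 0 := by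
  rw [of_sigma1, add_smul, one_smul, add_eq_left]

theorem of_sigma2_smul_iff (m : M) :
    MonoidAlgebra.of (ZMod 2) G (sigma2 e) • m = m ↔ aug2 e • m = 0 := by
  rw [of_sigma2, add_smul, one_smul, add_eq_left]

/-- Here 1 + σ₁σ₂ = a₁ + a₂ + a₁a₂. If this kills m, multiplying by a₁ gives a₁a₂m = 0, so the
quadratic term drops out. -/
theorem of_sigma12_smul_iff (m : M) :
    MonoidAlgebra.of (ZMod 2) G (sigma1 e * sigma2 e) • m = m ↔ aug1 e • m = aug2 e • m := by
  have key : MonoidAlgebra.of (ZMod 2) G (sigma1 e * sigma2 e) • m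
      = m + (aug1 e • m + aug2 e • m + aug1 e • aug2 e • m) := by
    rw [map_mul, of_sigma1, of_sigma2, mul_smul, add_smul, add_smul, one_smul, one_smul, smul_add]
    abel
  have two := add_self_of_groupAlgebra G (M := M)
  rw [key, add_eq_left]
  constructor
  · intro h
    have h' : aug1 e • (aug1 e • m + aug2 e • m + aug1 e • aug2 e • m) = 0 := by rw [h, smul_zero]
    rw [smul_add, smul_add, aug1_aug1, aug1_aug1, zero_add, add_zero] at h'
    rw [h', add_zero] at h
    rw [eq_neg_of_add_eq_zero_left h, ← eq_neg_of_add_eq_zero_left (two _)]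
  · intro h
    rw [← h, aug1_aug1, two, add_zero]

variable {e} in
theorem forall_mem_zpowers {s : G} (hs : s * s = 1) {m : M}
    (h : MonoidAlgebra.of (ZMod 2) G s • m = m) :
    ∀ g ∈ Subgroup.zpowers s, MonoidAlgebra.of (ZMod 2) G g • m = m := by
  intro g hg
  rcases mem_zpowers_of_mul_self hs hg with rfl | rfl
  · rw [map_one, one_smul]
  · exact h

end Stab

/-- The product a₁a₂ is the sum of all group elements, so the coefficient at the identity coset is
1. -/
theorem permGen_zero : aug1 e • aug2 e • permGen e 0 ≠ 0 := by
  have hne : ∀ g : G, g ≠ 1 → ((g : G ⧸ subgroupH e 0) ≠ (1 : G)) := by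
    intro g hg h
    have h' := QuotientGroup.eq.1 h
    rw [mul_one, inv_mem_iff] at h'
    exact hg (Subgroup.mem_bot.1 h')
  intro h
  have h1 : aug1 e • aug2 e • permGen e 0 = MonoidAlgebra.of (ZMod 2) G 1 • permGen e 0
      + MonoidAlgebra.of (ZMod 2) G (sigma1 e) • permGen e 0
      + MonoidAlgebra.of (ZMod 2) G (sigma2 e) • permGen e 0
      + MonoidAlgebra.of (ZMod 2) G (sigma1 e * sigma2 e) • permGen e 0 := by
    simp only [aug1, aug2, add_smul, smul_add, one_smul, map_one, map_mul, mul_smul]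
    abel
  rw [h1] at h
  simp only [of_permGen] at h
  have h2 := congrArg (fun n => MonoidAlgebra.coeff
    ((Representation.ofMulAction (ZMod 2) G (G ⧸ subgroupH e 0)).asModuleEquiv n)
      ((1 : G) : G ⧸ subgroupH e 0)) h
  simp [MonoidAlgebra.coeff_single, hne _ (sigma1_ne_one e),
    hne _ (sigma2_ne_one e), hne _ (sigma12_ne_one e), -QuotientGroup.mk_mul] at h2

theorem permGen_one : aug1 e • permGen e 1 ≠ 0 := by
  rw [Ne, ← of_sigma1_smul_iff]
  refine of_permGen_ne e _ _ fun h => ?_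
  rcases mem_zpowers_of_mul_self (sigma2_mul_self e) h with h | h
  · exact sigma1_ne_one e h
  · exact sigma1_ne_sigma2 e h

theorem permGen_two : aug2 e • permGen e 2 ≠ 0 := by
  rw [Ne, ← of_sigma2_smul_iff]
  refine of_permGen_ne e _ _ fun h => ?_
  rcases mem_zpowers_of_mul_self (sigma1_mul_self e) h with h | h
  · exact sigma2_ne_one e h
  · exact sigma1_ne_sigma2 e h.symm

theorem permGen_three : aug1 e • permGen e 3 ≠ 0 := by
  rw [Ne, ← of_sigma1_smul_iff]
  refine of_permGen_ne e _ _ fun h => ?_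
  rcases mem_zpowers_of_mul_self (sigma12_mul_self e) h with h | h
  · exact sigma1_ne_one e h
  · exact sigma2_ne_one e (by simpa using h)

theorem permGen_ne_zero (i : Fin 5) : permGen e i ≠ 0 := by
  intro h
  exact one_ne_zero (α := ZMod 2) (MonoidAlgebra.single_eq_zero.1 h)

theorem aug2_permGen_one : aug2 e • permGen e 1 = 0 :=
  (of_sigma2_smul_iff e _).1 (of_permGen_of_mem e 1 _ (Subgroup.mem_zpowers _))

theorem aug1_permGen_two : aug1 e • permGen e 2 = 0 :=
  (of_sigma1_smul_iff e _).1 (of_permGen_of_mem e 2 _ (Subgroup.mem_zpowers _))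

theorem aug_permGen_three : aug1 e • permGen e 3 = aug2 e • permGen e 3 :=
  (of_sigma12_smul_iff e _).1 (of_permGen_of_mem e 3 _ (Subgroup.mem_zpowers _))

theorem aug1_permGen_four : aug1 e • permGen e 4 = 0 :=
  (of_sigma1_smul_iff e _).1 (of_permGen_of_mem e 4 _ (Subgroup.mem_top _))

theorem aug2_permGen_four : aug2 e • permGen e 4 = 0 :=
  (of_sigma2_smul_iff e _).1 (of_permGen_of_mem e 4 _ (Subgroup.mem_top _))

/-- The element of the group algebra sending the generator of `PermMod e i` to its nonzero fixed
element. -/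
def permTop : Fin 5 → (ZMod 2)[G] := ![aug1 e * aug2 e, aug1 e, aug2 e, aug1 e, 1]

theorem permTop_ne_zero (i : Fin 5) : permTop e i • permGen e i ≠ 0 := by
  fin_cases i
  · change (aug1 e * aug2 e) • permGen e 0 ≠ 0
    rw [mul_smul]; exact permGen_zero e
  · exact permGen_one e
  · exact permGen_two e
  · exact permGen_three e
  · change (1 : (ZMod 2)[G]) • permGen e 4 ≠ 0
    rw [one_smul]; exact permGen_ne_zero e 4

theorem aug1_permTop (i : Fin 5) : aug1 e • permTop e i • permGen e i = 0 := by
  fin_cases i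
  · exact aug1_smul_mul_smul e _
  · exact aug1_aug1 e _
  · change aug1 e • aug2 e • permGen e 2 = 0
    rw [← aug2_aug1, aug1_permGen_two, smul_zero]
  · exact aug1_aug1 e _
  · change aug1 e • (1 : (ZMod 2)[G]) • permGen e 4 = 0
    rw [one_smul, aug1_permGen_four]

theorem aug2_permTop (i : Fin 5) : aug2 e • permTop e i • permGen e i = 0 := by
  fin_cases i
  · exact aug2_smul_mul_smul e _
  · change aug2 e • aug1 e • permGen e 1 = 0
    rw [aug2_aug1, aug2_permGen_one, smul_zero]
  · exact aug2_aug2 e _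
  · change aug2 e • aug1 e • permGen e 3 = 0
    rw [aug_permGen_three, aug2_aug2]
  · change aug2 e • (1 : (ZMod 2)[G]) • permGen e 4 = 0
    rw [one_smul, aug2_permGen_four]

variable {M : Type*} [AddCommGroup M] [Module (ZMod 2)[G] M] [Module (ZMod 2) M]
    [IsScalarTower (ZMod 2) (ZMod 2)[G] M]

/-- The fixed part of 𝔽₂[G/Hᵢ] is a line, so one copy per basis vector of `C` is needed, and `C`
becomes the whole fixed part of the sum. -/
theorem exists_perm_copies (i : Fin 5) (C : Submodule (ZMod 2) M)
    (hC : ∀ c ∈ C, ∃ m : M, (∀ g ∈ subgroupH e i, MonoidAlgebra.of (ZMod 2) G g • m = m) ∧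
      permTop e i • m = c) :
    ∃ Y : Submodule (ZMod 2)[G] M, IsSumOfCopies (ZMod 2)[G] (PermMod e i) Y ∧
      (∀ c ∈ C, ∃ m ∈ Y, (∀ g ∈ subgroupH e i, MonoidAlgebra.of (ZMod 2) G g • m = m) ∧
        permTop e i • m = c) ∧
      ∀ m ∈ Y, aug1 e • m = 0 → aug2 e • m = 0 → m ∈ C := by
  obtain ⟨Y, h1, h2, h3⟩ := exists_copies e (κ := Unit)
    (fun _ => permTop e i • permGen e i) (fun n hn1 hn2 => by
      rcases permMod_fixed e i _ (permTop_ne_zero e i) (aug1_permTop e i) (aug2_permTop e i)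
        n hn1 hn2 with h | h
      · exact ⟨0, by simp [h]⟩
      · exact ⟨1, by simp [h]⟩) C (fun _ => C.subtype)
    (fun v => by
      obtain ⟨m, hm, hv⟩ := hC v v.2
      obtain ⟨φ, hφ⟩ := exists_permHom e i m hm
      exact ⟨φ, fun _ => by rw [map_smul, hφ, hv]; rfl⟩)
    (fun v hv => by
      funext u
      simpa using hv)
  refine ⟨Y, h1, fun c hc => ?_, fun m hm k1 k2 => ?_⟩
  · obtain ⟨φ, hφ, h⟩ := h2 ⟨c, hc⟩
    refine ⟨φ (permGen e i), hφ _, fun g hg => ?_, ?_⟩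
    · rw [← map_smul, of_permGen_of_mem e i g hg]
    · rw [← map_smul]; exact h ()
  · obtain ⟨v, rfl⟩ := h3 m hm k1 k2
    simp

end Perm

section Omega
variable {M : Type*} [AddCommGroup M] [Module (ZMod 2)[G] M] [Module (ZMod 2) M]
    [IsScalarTower (ZMod 2) (ZMod 2)[G] M]

/-- The relations between the generators of `Ωⁿ`. -/
structure PosRel {n : ℕ} (γ : Fin (n + 1) → M) (δ : Fin n → M) : Prop where
  aug1_castSucc : ∀ j, aug1 e • γ j.castSucc = δ j
  aug1_last : aug1 e • γ (Fin.last n) = 0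
  aug2_succ : ∀ j, aug2 e • γ j.succ = δ j
  aug2_zero : aug2 e • γ 0 = 0

theorem smul_linearCombination {n : ℕ} (r : (ZMod 2)[G]) (γ : Fin n → M) (v : Fin n → ZMod 2) :
    r • Fintype.linearCombination (ZMod 2) γ v = ∑ i, v i • r • γ i := by
  rw [Fintype.linearCombination_apply, Finset.smul_sum]
  exact Finset.sum_congr rfl fun i _ => smul_comm _ _ _

variable {e} in
theorem PosRel.exists_hom {n : ℕ} {γ : Fin (n + 1) → M} {δ : Fin n → M} (h : PosRel e γ δ) :
    ∃ φ : OmegaPos e n →ₗ[(ZMod 2)[G]] M,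
      ∀ v w, φ (tsMk e (dropLast n) (dropFirst n) v w) = ∑ i, v i • γ i + ∑ j, w j • δ j :=
  ⟨tsHom e _ _ (Fintype.linearCombination (ZMod 2) γ) (Fintype.linearCombination (ZMod 2) δ)
    (fun v => by
      rw [smul_linearCombination, Fin.sum_univ_castSucc, h.aug1_last, smul_zero, add_zero]
      simp only [h.aug1_castSucc]; rfl)
    (fun v => by
      rw [smul_linearCombination, Fin.sum_univ_succ, h.aug2_zero, smul_zero, zero_add]
      simp only [h.aug2_succ]; rfl)
    (fun w => by
      rw [smul_linearCombination]
      exact Finset.sum_eq_zero fun j _ => by rw [← h.aug1_castSucc, aug1_aug1, smul_zero])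
    (fun w => by
      rw [smul_linearCombination]
      exact Finset.sum_eq_zero fun j _ => by rw [← h.aug2_succ, aug2_aug2, smul_zero]),
    fun _ _ => rfl⟩

/-- Vanishing under a₂ kills every coordinate of the γ-part but the first, and a₁ kills that one.
For n = 0 the single γ is itself fixed, hence the restriction on n. -/
theorem omegaPos_fixed {n : ℕ} [NeZero n] (m : OmegaPos e n) (h1 : aug1 e • m = 0)
    (h2 : aug2 e • m = 0) : ∃ w, m = tsMk e (dropLast n) (dropFirst n) 0 w := by
  refine tsMk_mem_of_fixed (fun v hv1 hv2 => ?_) m h1 h2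
  funext j
  refine Fin.cases ?_ (fun j => congrFun hv2 j) j
  obtain ⟨k, rfl⟩ := Nat.exists_eq_succ_of_ne_zero (NeZero.ne n)
  exact congrFun hv1 0

theorem exists_pos_copies (n : ℕ) [NeZero n] (E : Submodule (ZMod 2) M)
    (ψ : Fin n → E →ₗ[ZMod 2] M)
    (hψ : ∀ v : E, ∃ γ : Fin (n + 1) → M, PosRel e γ fun j => ψ j v)
    (hinj : ∀ v : Fin n → E, ∑ j, ψ j (v j) = 0 → v = 0) :
    ∃ Y : Submodule (ZMod 2)[G] M, IsSumOfCopies (ZMod 2)[G] (OmegaPos e n) Y ∧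
      (∀ v : E, ∃ γ : Fin (n + 1) → M, (∀ i, γ i ∈ Y) ∧ PosRel e γ fun j => ψ j v) ∧
      ∀ m ∈ Y, aug1 e • m = 0 → aug2 e • m = 0 → ∃ v : Fin n → E, m = ∑ j, ψ j (v j) := by
  let d : Fin n → OmegaPos e n := fun j => tsMk e (dropLast n) (dropFirst n) 0 (Pi.single j 1)
  let g : Fin (n + 1) → OmegaPos e n := fun j =>
    tsMk e (dropLast n) (dropFirst n) (Pi.single j 1) 0
  have hrel : PosRel e g d := by
    refine ⟨fun j => ?_, ?_, fun j => ?_, ?_⟩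
    · rw [aug1_tsMk, tsMk_inj]; refine ⟨rfl, ?_⟩
      funext k; simp [dropLast, LinearMap.funLeft_apply, Pi.single_apply]
    · rw [aug1_tsMk, tsMk_eq_zero]; refine ⟨rfl, ?_⟩
      funext k; simp [dropLast, LinearMap.funLeft_apply]
    · rw [aug2_tsMk, tsMk_inj]; refine ⟨rfl, ?_⟩
      funext k; simp [dropFirst, LinearMap.funLeft_apply, Pi.single_apply]
    · rw [aug2_tsMk, tsMk_eq_zero]; refine ⟨rfl, ?_⟩
      funext k; simp [dropFirst, LinearMap.funLeft_apply]
  obtain ⟨Y, h1, h2, h3⟩ := exists_copies e d (fun m hm1 hm2 => by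
      obtain ⟨w, rfl⟩ := omegaPos_fixed e m hm1 hm2
      refine ⟨w, ?_⟩
      let L : (Fin n → ZMod 2) →ₗ[ZMod 2] OmegaPos e n :=
        (twoStep e (dropLast n) (dropFirst n)).asModuleEquiv.symm.toLinearMap ∘ₗ
          LinearMap.inr (ZMod 2) _ _
      change L w = ∑ j, w j • L (Pi.single j 1)
      conv_lhs => rw [pi_eq_sum_univ' w]
      rw [map_sum]
      refine Finset.sum_congr rfl fun j _ => ?_
      rw [map_smul]) E ψ
    (fun v => by
      obtain ⟨γ, hγ⟩ := hψ v
      obtain ⟨φ, hφ⟩ := hγ.exists_hom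
      exact ⟨φ, fun j => by simp [d, hφ, Pi.single_apply]⟩) hinj
  refine ⟨Y, h1, fun v => ?_, h3⟩
  obtain ⟨φ, hφ, hd⟩ := h2 v
  refine ⟨fun i => φ (g i), fun i => hφ _, ?_, ?_, ?_, ?_⟩
  · intro j; rw [← map_smul, hrel.aug1_castSucc, hd]
  · rw [← map_smul, hrel.aug1_last, map_zero]
  · intro j; rw [← map_smul, hrel.aug2_succ, hd]
  · rw [← map_smul, hrel.aug2_zero, map_zero]

/-- The relations between the generators of `Ω⁻ⁿ`. -/
structure NegRel {n : ℕ} (α : Fin n → M) (β : Fin (n + 1) → M) : Prop where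
  aug1_eq : ∀ i, aug1 e • α i = β i.succ
  aug2_eq : ∀ i, aug2 e • α i = β i.castSucc
  aug1_zero : ∀ j, aug1 e • β j = 0
  aug2_zero : ∀ j, aug2 e • β j = 0

variable {e} in
theorem NegRel.exists_hom {n : ℕ} {α : Fin n → M} {β : Fin (n + 1) → M} (h : NegRel e α β) :
    ∃ φ : OmegaNeg e n →ₗ[(ZMod 2)[G]] M,
      ∀ v w, φ (tsMk e (prependZero n) (appendZero n) v w) = ∑ i, v i • α i + ∑ j, w j • β j :=
  ⟨tsHom e _ _ (Fintype.linearCombination (ZMod 2) α) (Fintype.linearCombination (ZMod 2) β)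
    (fun v => by
      rw [smul_linearCombination, Fintype.linearCombination_apply, Fin.sum_univ_succ]
      simp [h.aug1_eq, prependZero])
    (fun v => by
      rw [smul_linearCombination, Fintype.linearCombination_apply, Fin.sum_univ_castSucc]
      simp [h.aug2_eq, appendZero])
    (fun w => by
      rw [smul_linearCombination]
      exact Finset.sum_eq_zero fun j _ => by rw [h.aug1_zero, smul_zero])
    (fun w => by
      rw [smul_linearCombination]
      exact Finset.sum_eq_zero fun j _ => by rw [h.aug2_zero, smul_zero]),
    fun _ _ => rfl⟩

theorem omegaNeg_fixed {n : ℕ} (m : OmegaNeg e n) (h1 : aug1 e • m = 0)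
    (h2 : aug2 e • m = 0) : ∃ w, m = tsMk e (prependZero n) (appendZero n) 0 w := by
  refine tsMk_mem_of_fixed (fun v hv1 hv2 => ?_) m h1 h2
  funext j
  simpa [prependZero] using congrFun hv1 j.succ

variable {e} in
-- The β's span the fixed part of Ω⁻ⁿ, so their independence alone makes the induced map injective.
theorem NegRel.exists_submodule {n : ℕ} {α : Fin n → M} {β : Fin (n + 1) → M} (h : NegRel e α β)
    (hβ : ∀ w : Fin (n + 1) → ZMod 2, ∑ j, w j • β j = 0 → w = 0) :
    ∃ X : Submodule (ZMod 2)[G] M, Nonempty (X ≃ₗ[(ZMod 2)[G]] OmegaNeg e n) ∧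
      (∀ i, α i ∈ X) ∧ ∀ m ∈ X, aug1 e • m = 0 → aug2 e • m = 0 → ∃ w : Fin (n + 1) → ZMod 2,
        m = ∑ j, w j • β j := by
  obtain ⟨φ, hφ⟩ := h.exists_hom
  have hinj : Function.Injective φ := by
    refine injective_of_fixed e φ fun m h1 h2 h0 => ?_
    obtain ⟨w, rfl⟩ := omegaNeg_fixed e m h1 h2
    rw [hφ] at h0
    rw [hβ w (by simpa using h0), tsMk_zero]
  refine ⟨LinearMap.range φ, ⟨(LinearEquiv.ofInjective φ hinj).symm⟩, fun i => ?_, ?_⟩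
  · exact ⟨tsMk e _ _ (Pi.single i 1) 0, by simp [hφ, Pi.single_apply]⟩
  · rintro _ ⟨m, rfl⟩ h1 h2
    obtain ⟨w, rfl⟩ := omegaNeg_fixed e m (hinj (by rw [map_smul, h1, map_zero]))
      (hinj (by rw [map_smul, h2, map_zero]))
    exact ⟨w, by simp [hφ]⟩

variable {e} in
theorem NegRel.exists_submodule_prod {n : ℕ} {α α' : Fin n → M} {β β' : Fin (n + 1) → M}
    (h : NegRel e α β) (h' : NegRel e α' β')
    (hβ : ∀ w w' : Fin (n + 1) → ZMod 2, ∑ j, w j • β j + ∑ j, w' j • β' j = 0 → w = 0 ∧ w' = 0) :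
    ∃ X : Submodule (ZMod 2)[G] M, Nonempty (X ≃ₗ[(ZMod 2)[G]] OmegaNeg e n × OmegaNeg e n) ∧
      (∀ i, α i ∈ X) ∧ (∀ i, α' i ∈ X) ∧
      ∀ m ∈ X, aug1 e • m = 0 → aug2 e • m = 0 → ∃ w w' : Fin (n + 1) → ZMod 2,
        m = ∑ j, w j • β j + ∑ j, w' j • β' j := by
  obtain ⟨φ, hφ⟩ := h.exists_hom
  obtain ⟨φ', hφ'⟩ := h'.exists_hom
  have hinj : Function.Injective (φ.coprod φ') := by
    refine injective_of_fixed e _ ?_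
    rintro ⟨m, m'⟩ h1 h2 h0
    obtain ⟨w, rfl⟩ := omegaNeg_fixed e m (congrArg Prod.fst h1) (congrArg Prod.fst h2)
    obtain ⟨w', rfl⟩ := omegaNeg_fixed e m' (congrArg Prod.snd h1) (congrArg Prod.snd h2)
    rw [LinearMap.coprod_apply, hφ, hφ'] at h0
    obtain ⟨rfl, rfl⟩ := hβ w w' (by simpa using h0)
    rw [tsMk_zero]; rfl
  refine ⟨LinearMap.range (φ.coprod φ'), ⟨(LinearEquiv.ofInjective _ hinj).symm⟩,
    fun i => ?_, fun i => ?_, ?_⟩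
  · exact ⟨(tsMk e _ _ (Pi.single i 1) 0, 0), by simp [hφ, Pi.single_apply]⟩
  · exact ⟨(0, tsMk e _ _ (Pi.single i 1) 0), by simp [hφ', Pi.single_apply]⟩
  · rintro _ ⟨⟨m, m'⟩, rfl⟩ h1 h2
    have k1 : aug1 e • (m, m') = 0 := hinj (by rw [map_smul, h1, map_zero])
    have k2 : aug2 e • (m, m') = 0 := hinj (by rw [map_smul, h2, map_zero])
    obtain ⟨w, rfl⟩ := omegaNeg_fixed e m (congrArg Prod.fst k1) (congrArg Prod.fst k2)
    obtain ⟨w', rfl⟩ := omegaNeg_fixed e m' (congrArg Prod.snd k1) (congrArg Prod.snd k2)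
    exact ⟨w, w', by simp [hφ, hφ']⟩

end Omega
end Summands

/-! ### The exceptional summand X. -/

section Decomposition
variable {G : Type*} [Group G] (e : G ≃* Multiplicative (ZMod 2 × ZMod 2))

/-- `X` is zero or isomorphic to `Ω⁻¹`, `Ω⁻²` or `Ω⁻¹ ⊕ Ω⁻¹`. -/
def IsExceptional (X : Type*) [AddCommGroup X] [Module (ZMod 2)[G] X] : Prop :=
  Subsingleton X ∨
    Nonempty (X ≃ₗ[(ZMod 2)[G]] OmegaNeg e 1) ∨
    Nonempty (X ≃ₗ[(ZMod 2)[G]] OmegaNeg e 2) ∨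
    Nonempty (X ≃ₗ[(ZMod 2)[G]] OmegaNeg e 1 × OmegaNeg e 1)

section LinearAlgebra
variable {k M : Type*} [Field k] [AddCommGroup M] [Module k M]

theorem exists_complement_of_le {A B : Submodule k M} (h : A ≤ B) :
    ∃ C ≤ B, (∀ m ∈ A, m ∈ C → m = 0) ∧ ∀ b ∈ B, ∃ a ∈ A, ∃ c ∈ C, a + c = b := by
  obtain ⟨C, hC⟩ := Submodule.exists_isCompl A
  refine ⟨C ⊓ B, inf_le_right, fun m hA hm => Submodule.disjoint_def.1 hC.disjoint m hA hm.1, ?_⟩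
  intro b hb
  refine Submodule.mem_sup.1 ?_
  rw [← sup_inf_assoc_of_le _ h, hC.sup_eq_top, top_inf_eq]
  exact hb

/-- Choosing the two components only on a basis makes them linear, as `exists_copies` requires. -/
theorem exists_splitting {A B E : Submodule k M} (h : E ≤ A ⊔ B) :
    ∃ p q : E →ₗ[k] M, (∀ v, p v ∈ A) ∧ (∀ v, q v ∈ B) ∧ ∀ v, p v + q v = v := by
  let b := Module.Basis.ofVectorSpace k E
  have hb : ∀ i, ∃ a : A, ∃ c : B, (a : M) + c = b i := fun i => by
    obtain ⟨a, ha, c, hc, hs⟩ := Submodule.mem_sup.1 (h (b i).2)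
    exact ⟨⟨a, ha⟩, ⟨c, hc⟩, hs⟩
  choose a c hac using hb
  refine ⟨A.subtype ∘ₗ b.constr k a, B.subtype ∘ₗ b.constr k c, fun v => Subtype.property _,
    fun v => Subtype.property _, fun v => ?_⟩
  have : A.subtype ∘ₗ b.constr k a + B.subtype ∘ₗ b.constr k c = E.subtype := by
    refine b.ext fun i => ?_
    simp [hac]
  exact LinearMap.congr_fun this v

end LinearAlgebra

variable {e} in
theorem negRel_of_aug {M : Type*} [AddCommGroup M] [Module (ZMod 2)[G] M] {m : M}
    (hm : aug1 e • aug2 e • m = 0) :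
    NegRel e ![m] ![aug2 e • m, aug1 e • m] := by
  refine ⟨fun i => ?_, fun i => ?_, fun j => ?_, fun j => ?_⟩
  · fin_cases i; rfl
  · fin_cases i; rfl
  · fin_cases j
    · exact hm
    · exact aug1_aug1 e m
  · fin_cases j
    · exact aug2_aug2 e m
    · exact (aug2_aug1 e m).trans hm

variable {e} in
theorem negRel_two_of_aug {M : Type*} [AddCommGroup M] [Module (ZMod 2)[G] M] {m m' : M}
    (hm : aug1 e • aug2 e • m = 0)
    (hm' : aug1 e • aug2 e • m' = 0) (h : aug1 e • m = aug2 e • m') :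
    NegRel e ![m, m'] ![aug2 e • m, aug1 e • m, aug1 e • m'] := by
  refine ⟨fun i => ?_, fun i => ?_, fun j => ?_, fun j => ?_⟩
  · fin_cases i <;> rfl
  · fin_cases i
    · rfl
    · exact h.symm
  · fin_cases j
    · exact hm
    · exact aug1_aug1 e m
    · exact aug1_aug1 e m'
  · fin_cases j
    · exact aug2_aug2 e m
    · exact (aug2_aug1 e m).trans hm
    · exact (aug2_aug1 e m').trans hm'

variable {M : Type*} [AddCommGroup M] [Module (ZMod 2)[G] M] [Module (ZMod 2) M]
    [IsScalarTower (ZMod 2) (ZMod 2)[G] M]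

/-- Multiplication by an element of the group algebra as an `𝔽₂`-linear map. -/
def actMap (M : Type*) [AddCommGroup M] [Module (ZMod 2)[G] M] [Module (ZMod 2) M]
    [IsScalarTower (ZMod 2) (ZMod 2)[G] M] (r : (ZMod 2)[G]) : M →ₗ[ZMod 2] M where
  toFun m := r • m
  map_add' := smul_add r
  map_smul' c m := smul_comm r c m

@[simp] theorem actMap_apply (r : (ZMod 2)[G]) (m : M) : actMap M r m = r • m := rfl

/-- The elements of `M` fixed by the group. -/
def fixedPart (M : Type*) [AddCommGroup M] [Module (ZMod 2)[G] M] [Module (ZMod 2) M]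
    [IsScalarTower (ZMod 2) (ZMod 2)[G] M] : Submodule (ZMod 2) M :=
  LinearMap.ker (actMap M (aug1 e)) ⊓ LinearMap.ker (actMap M (aug2 e))

theorem mem_fixedPart {m : M} : m ∈ fixedPart e M ↔ aug1 e • m = 0 ∧ aug2 e • m = 0 := Iff.rfl

/-- The elements of `U` of the form `(1 + σ₁) m` with `(1 + σ₂) m = 0`. -/
def norms1 (U : Submodule (ZMod 2) M) : Submodule (ZMod 2) M :=
  (LinearMap.ker (actMap M (aug2 e))).map (actMap M (aug1 e)) ⊓ U

/-- The elements of `U` of the form `(1 + σ₂) m` with `(1 + σ₁) m = 0`. -/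
def norms2 (U : Submodule (ZMod 2) M) : Submodule (ZMod 2) M :=
  (LinearMap.ker (actMap M (aug1 e))).map (actMap M (aug2 e)) ⊓ U

/-- The elements of `U` of the form `(1 + σ₁) m = (1 + σ₂) m`. -/
def norms3 (U : Submodule (ZMod 2) M) : Submodule (ZMod 2) M :=
  (LinearMap.ker (actMap M (aug1 e) - actMap M (aug2 e))).map (actMap M (aug1 e)) ⊓ U

variable {e} {U : Submodule (ZMod 2) M}

theorem mem_norms1 {u : M} :
    u ∈ norms1 e U ↔ u ∈ U ∧ ∃ m, aug1 e • m = u ∧ aug2 e • m = 0 :=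
  ⟨fun ⟨⟨m, h2, h1⟩, hu⟩ => ⟨hu, m, h1, h2⟩, fun ⟨hu, m, h1, h2⟩ => ⟨⟨m, h2, h1⟩, hu⟩⟩

theorem mem_norms2 {u : M} :
    u ∈ norms2 e U ↔ u ∈ U ∧ ∃ m, aug1 e • m = 0 ∧ aug2 e • m = u :=
  ⟨fun ⟨⟨m, h2, h1⟩, hu⟩ => ⟨hu, m, h2, h1⟩, fun ⟨hu, m, h1, h2⟩ => ⟨⟨m, h1, h2⟩, hu⟩⟩

theorem mem_norms3 {u : M} :
    u ∈ norms3 e U ↔ u ∈ U ∧ ∃ m, aug1 e • m = u ∧ aug2 e • m = u := by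
  constructor
  · rintro ⟨⟨m, h2, h1⟩, hu⟩
    refine ⟨hu, m, h1, ?_⟩
    rw [← sub_eq_zero.1 (show aug1 e • m - aug2 e • m = 0 from h2)]
    exact h1
  · rintro ⟨hu, m, h1, h2⟩
    exact ⟨⟨m, show aug1 e • m - aug2 e • m = 0 by rw [h1, h2, sub_self], h1⟩, hu⟩

/-- If (u, 0) and (0, u) are both values of m ↦ (a₁m, a₂m), so is (u, u). With its two analogues
below, this makes all pairwise intersections of the three norm subspaces equal. -/
theorem norms1_inf_norms2_le : norms1 e U ⊓ norms2 e U ≤ norms3 e U := by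
  rintro u ⟨h1, h2⟩
  obtain ⟨hu, m, h1, h1'⟩ := mem_norms1.1 h1
  obtain ⟨-, m', h2, h2'⟩ := mem_norms2.1 h2
  exact mem_norms3.2 ⟨hu, m + m', by rw [smul_add, h1, h2, add_zero],
    by rw [smul_add, h1', h2', zero_add]⟩

theorem norms1_inf_norms3_le : norms1 e U ⊓ norms3 e U ≤ norms2 e U := by
  rintro u ⟨h1, h2⟩
  obtain ⟨hu, m, h1, h1'⟩ := mem_norms1.1 h1
  obtain ⟨-, m', h2, h2'⟩ := mem_norms3.1 h2
  exact mem_norms2.2 ⟨hu, m' - m, by rw [smul_sub, h1, h2, sub_self],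
    by rw [smul_sub, h1', h2', sub_zero]⟩

theorem norms2_inf_norms3_le : norms2 e U ⊓ norms3 e U ≤ norms1 e U := by
  rintro u ⟨h1, h2⟩
  obtain ⟨hu, m, h1, h1'⟩ := mem_norms2.1 h1
  obtain ⟨-, m', h2, h2'⟩ := mem_norms3.1 h2
  exact mem_norms1.2 ⟨hu, m' - m, by rw [smul_sub, h1, h2, sub_zero],
    by rw [smul_sub, h1', h2', sub_self]⟩

variable (e U) in
/-- The sum of the three norm subspaces. -/
def normsSup : Submodule (ZMod 2) M := norms1 e U ⊔ norms2 e U ⊔ norms3 e U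

theorem normsSup_le : normsSup e U ≤ U :=
  sup_le (sup_le inf_le_right inf_le_right) inf_le_right

theorem zmod_two_eq (a : ZMod 2) : a = 0 ∨ a = 1 := by revert a; decide

/-- On ker(a₁a₂) the relations `hT` express all signs of a₁m and a₂m through the pair (T₀(a₁m),
T₁(a₂m)), so both lie in U once that pair is zero. The pairs form a subspace of 𝔽₂². Dimension 0
gives X = 0 and dimension 1 gives Ω⁻¹. In dimension 2, lifts of (0, 1) and (1, 0) generate either
Ω⁻² or Ω⁻¹ ⊕ Ω⁻¹. -/
theorem exists_exceptional (T : Fin 3 → M →ₗ[ZMod 2] ZMod 2)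
    (hTU : ∀ m, aug1 e • m = 0 → aug2 e • m = 0 → (m ∈ U ↔ ∀ i, T i m = 0))
    (hU1 : ∀ u ∈ U, aug1 e • u = 0) (hU2 : ∀ u ∈ U, aug2 e • u = 0)
    (hT : ∀ m, aug1 e • aug2 e • m = 0 → T 1 (aug1 e • m) = 0 ∧ T 0 (aug2 e • m) = 0 ∧
      T 2 (aug1 e • m) = T 0 (aug1 e • m) + T 1 (aug2 e • m) ∧
      T 2 (aug2 e • m) = T 0 (aug1 e • m) + T 1 (aug2 e • m)) :
    ∃ X : Submodule (ZMod 2)[G] M, IsExceptional e X ∧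
      (∀ m ∈ X, aug1 e • m = 0 → aug2 e • m = 0 → m ∈ normsSup e U → m = 0) ∧
      ∀ m, aug1 e • aug2 e • m = 0 → ∃ ξ ∈ X, aug1 e • (m - ξ) ∈ U ∧ aug2 e • (m - ξ) ∈ U := by
  have hzero : ∀ u ∈ U, ∀ i, T i u = 0 := fun u hu => (hTU u (hU1 u hu) (hU2 u hu)).1 hu
  have hmem : ∀ m, aug1 e • aug2 e • m = 0 → T 0 (aug1 e • m) = 0 → T 1 (aug2 e • m) = 0 →
      aug1 e • m ∈ U ∧ aug2 e • m ∈ U := by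
    intro m hm ha hb
    obtain ⟨h1, h2, h3, h4⟩ := hT m hm
    rw [ha, hb, add_zero] at h3 h4
    constructor
    · refine (hTU _ (aug1_aug1 e m) ((aug2_aug1 e m).trans hm)).2 fun i => ?_
      fin_cases i <;> assumption
    · refine (hTU _ hm (aug2_aug2 e m)).2 fun i => ?_
      fin_cases i <;> assumption
  by_cases h10 : ∃ m, aug1 e • aug2 e • m = 0 ∧ T 0 (aug1 e • m) = 1 ∧ T 1 (aug2 e • m) = 0
  on_goal 1 =>
    by_cases h01 : ∃ m, aug1 e • aug2 e • m = 0 ∧ T 0 (aug1 e • m) = 0 ∧ T 1 (aug2 e • m) = 1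
  · obtain ⟨m', hm', ha', hb'⟩ := h10
    obtain ⟨m, hm, ha, hb⟩ := h01
    have span : ∀ m m' : M, aug1 e • aug2 e • m = 0 → aug1 e • aug2 e • m' = 0 →
        T 0 (aug1 e • m) = 0 → T 1 (aug2 e • m) = 1 → T 0 (aug1 e • m') = 1 →
        T 1 (aug2 e • m') = 0 → ∀ X : Submodule (ZMod 2)[G] M, m ∈ X → m' ∈ X →
        ∀ n, aug1 e • aug2 e • n = 0 →
          ∃ ξ ∈ X, aug1 e • (n - ξ) ∈ U ∧ aug2 e • (n - ξ) ∈ U := by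
      intro m m' hm hm' ha hb ha' hb' X hX hX' n hn
      have key : ∀ ξ ∈ X, aug1 e • aug2 e • ξ = 0 → T 0 (aug1 e • ξ) = T 0 (aug1 e • n) →
          T 1 (aug2 e • ξ) = T 1 (aug2 e • n) →
          ∃ ξ ∈ X, aug1 e • (n - ξ) ∈ U ∧ aug2 e • (n - ξ) ∈ U := fun ξ hξ h h1 h2 =>
        ⟨ξ, hξ, hmem _ (by rw [smul_sub, smul_sub, hn, h, sub_zero])
          (by rw [smul_sub, map_sub, h1, sub_self]) (by rw [smul_sub, map_sub, h2, sub_self])⟩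
      rcases zmod_two_eq (T 0 (aug1 e • n)) with h1 | h1 <;>
        rcases zmod_two_eq (T 1 (aug2 e • n)) with h2 | h2
      · exact key 0 X.zero_mem (by simp) (by simp [h1]) (by simp [h2])
      · exact key m hX hm (by rw [ha, h1]) (by rw [hb, h2])
      · exact key m' hX' hm' (by rw [ha', h1]) (by rw [hb', h2])
      · exact key (m + m') (X.add_mem hX hX') (by simp [smul_add, hm, hm'])
          (by simp [smul_add, ha, ha', h1]) (by simp [smul_add, hb, hb', h2])
    -- The elements a₁m and a₂m' have the same signs (0, 0, 1), and this is the only coincidence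
    -- among the four fixed elements. The question is whether their difference, which lies in U, can
    -- be removed by norms.
    by_cases hf : aug1 e • m - aug2 e • m' ∈ normsSup e U
    · obtain ⟨w, hw, w3, hw3, hs⟩ := Submodule.mem_sup.1 hf
      obtain ⟨w1, hw1, w2, hw2, rfl⟩ := Submodule.mem_sup.1 hw
      obtain ⟨hu1, g1, k1, k1'⟩ := mem_norms1.1 hw1
      obtain ⟨hu2, g2, k2, k2'⟩ := mem_norms2.1 hw2
      obtain ⟨hu3, g3, k3, k3'⟩ := mem_norms3.1 hw3
      -- Preimages of the norm components are moved into m and m' until a₁n = a₂n' exactly, as Ω⁻²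
      -- requires. Both pairs survive because the corrections change a₁ and a₂ only by elements of
      -- U.
      have hn : aug1 e • aug2 e • (m - g1 - g3) = 0 := by
        simp only [smul_sub, k1', k3', hm, hU1 _ hu3, sub_zero]
      have hn' : aug1 e • aug2 e • (m' + g2) = 0 := by
        rw [smul_add, k2', smul_add, hm', hU1 _ hu2, add_zero]
      have na : T 0 (aug1 e • (m - g1 - g3)) = 0 := by
        rw [smul_sub, smul_sub, k1, k3, map_sub, map_sub, ha, hzero _ hu1, hzero _ hu3]; simp
      have nb : T 1 (aug2 e • (m - g1 - g3)) = 1 := by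
        rw [smul_sub, smul_sub, k1', k3', map_sub, map_sub, hb, hzero _ hu3]; simp
      have na' : T 0 (aug1 e • (m' + g2)) = 1 := by
        rw [smul_add, k2, map_add, ha']; simp
      have nb' : T 1 (aug2 e • (m' + g2)) = 0 := by
        rw [smul_add, k2', map_add, hb', hzero _ hu2, add_zero]
      have heq : aug1 e • (m - g1 - g3) = aug2 e • (m' + g2) := by
        have hs' : aug1 e • m = aug2 e • m' + (w1 + w2 + w3) := by rw [hs]; abel
        simp only [smul_sub, smul_add, k1, k3, k2', hs']
        abel
      generalize m - g1 - g3 = n at hn na nb heq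
      generalize m' + g2 = n' at hn' na' nb' heq
      have hcoef : ∀ w : Fin 3 → ZMod 2,
          ∑ j, w j • ![aug2 e • n, aug1 e • n, aug1 e • n'] j ∈ U → w = 0 := by
        intro w hw
        have h := hzero _ hw
        obtain ⟨t1, t2, t3, t4⟩ := hT n hn
        obtain ⟨t1', t2', t3', t4'⟩ := hT n' hn'
        have e0 := h 0
        have e1 := h 1
        have e2 := h 2
        simp [Fin.sum_univ_three, t1, t2, t3, t4, t1', t3', na, nb, na', nb']
          at e0 e1 e2
        rw [e0, e1] at e2
        funext j
        fin_cases j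
        · exact e1
        · simpa using e2
        · exact e0
      obtain ⟨X, hX, hα, hfix⟩ := (negRel_two_of_aug hn hn' heq).exists_submodule (fun w hw =>
        hcoef w (by rw [hw]; exact U.zero_mem))
      refine ⟨X, Or.inr (Or.inr (Or.inl hX)), ?_, span n n' hn hn' na nb na' nb' X (hα 0) (hα 1)⟩
      intro ξ hξ h1 h2 hs
      obtain ⟨w, rfl⟩ := hfix ξ hξ h1 h2
      rw [hcoef w (normsSup_le hs)]
      simp
    · have hcoef : ∀ w w' : Fin 2 → ZMod 2, ∑ j, w j • ![aug2 e • m, aug1 e • m] j +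
          ∑ j, w' j • ![aug2 e • m', aug1 e • m'] j ∈ normsSup e U → w = 0 ∧ w' = 0 := by
        intro w w' hw
        have h := hzero _ (normsSup_le hw)
        obtain ⟨t1, t2, t3, t4⟩ := hT m hm
        obtain ⟨t1', t2', t3', t4'⟩ := hT m' hm'
        have e0 := h 0
        have e1 := h 1
        have e2 := h 2
        simp [t1, t2, t3, t4, t1', t2', t3', t4', ha, hb, ha', hb'] at e0 e1 e2
        rw [e0, e1, zero_add, add_zero] at e2
        -- The signs force the coefficients of a₁m and a₂m' to agree; the negated hypothesis `hf`
        -- then forces the common value to be 0.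
        rw [add_eq_zero_iff_eq_neg, ZModModule.neg_eq_self] at e2
        have e3 : w 1 = 0 := by
          refine (zmod_two_eq _).resolve_right fun h1 => hf ?_
          rw [ZModModule.sub_eq_add]
          simpa [e0, e1, ← e2, h1] using hw
        constructor
        · funext j
          fin_cases j
          · exact e1
          · exact e3
        · funext j
          fin_cases j
          · exact e2.symm.trans e3
          · exact e0
      obtain ⟨X, hX, hα, hα', hfix⟩ := (negRel_of_aug hm).exists_submodule_prod
        (negRel_of_aug hm') (fun w w' hw => hcoef w w' (by rw [hw]; exact Submodule.zero_mem _))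
      refine ⟨X, Or.inr (Or.inr (Or.inr hX)), ?_, span m m' hm hm' ha hb ha' hb' X (hα 0) (hα' 0)⟩
      intro ξ hξ h1 h2 hs
      obtain ⟨w, w', rfl⟩ := hfix ξ hξ h1 h2
      obtain ⟨rfl, rfl⟩ := hcoef w w' hs
      simp
  all_goals
    by_cases h0 : ∃ m, aug1 e • aug2 e • m = 0 ∧
      ¬ (T 0 (aug1 e • m) = 0 ∧ T 1 (aug2 e • m) = 0)
    swap
    · push Not at h0
      refine ⟨⊥, Or.inl inferInstance, fun m hm _ _ _ => (Submodule.mem_bot _).1 hm,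
        fun m hm => ⟨0, Submodule.zero_mem _, ?_⟩⟩
      rw [sub_zero]
      exact hmem m hm (h0 m hm).1 (h0 m hm).2
    obtain ⟨m, hm, hab⟩ := h0
    -- In both remaining branches some nonzero pair is missing, so the subspace of pairs is proper
    -- and has at most one nonzero element. The anonymous hypothesis used below is the missing pair
    -- of the current branch.
    have huniq : ∀ n, aug1 e • aug2 e • n = 0 → 
        ¬ (T 0 (aug1 e • n) = 0 ∧ T 1 (aug2 e • n) = 0) →
        T 0 (aug1 e • n) = T 0 (aug1 e • m) ∧ T 1 (aug2 e • n) = T 1 (aug2 e • m) := by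
      intro n hn hn0
      by_contra hne
      have hs := not_exists.1 ‹¬ ∃ _, _›
      have s1 := hs m
      have s2 := hs n
      have s3 := hs (m + n)
      simp only [smul_add, map_add, hm, hn, true_and, add_zero] at s1 s2 s3
      generalize T 0 (aug1 e • m) = a at *
      generalize T 1 (aug2 e • m) = b at *
      generalize T 0 (aug1 e • n) = a' at *
      generalize T 1 (aug2 e • n) = b' at *
      clear * - hab hn0 hne s1 s2 s3
      rcases zmod_two_eq a with rfl | rfl <;> rcases zmod_two_eq b with rfl | rfl <;>
        rcases zmod_two_eq a' with rfl | rfl <;> rcases zmod_two_eq b' with rfl | rfl <;>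
        revert hab hn0 hne s1 s2 s3 <;> decide
    have hcoef : ∀ w : Fin 2 → ZMod 2,
        ∑ j, w j • ![aug2 e • m, aug1 e • m] j ∈ U → w = 0 := by
      intro w hw
      have h := hzero _ hw
      obtain ⟨t1, t2, t3, t4⟩ := hT m hm
      have e0 := h 0
      have e1 := h 1
      have e2 := h 2
      simp only [Fin.sum_univ_two, Matrix.cons_val_zero, Matrix.cons_val_one, map_add, map_smul,
        t1, t2, t3, t4, smul_eq_mul, mul_zero, add_zero, zero_add] at e0 e1 e2
      have : w 0 = 0 ∧ w 1 = 0 := by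
        generalize T 0 (aug1 e • m) = a at *
        generalize T 1 (aug2 e • m) = b at *
        generalize w 0 = c at *
        generalize w 1 = d at *
        clear * - hab e0 e1 e2
        revert a b c d
        decide
      funext j
      fin_cases j
      · exact this.1
      · exact this.2
    obtain ⟨X, hX, hα, hfix⟩ := (negRel_of_aug hm).exists_submodule (fun w hw =>
      hcoef w (by rw [hw]; exact U.zero_mem))
    refine ⟨X, Or.inr (Or.inl hX), fun ξ hξ h1 h2 hs => ?_, fun n hn => ?_⟩
    · obtain ⟨w, rfl⟩ := hfix ξ hξ h1 h2
      rw [hcoef w (normsSup_le hs)]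
      simp
    · by_cases hn0 : T 0 (aug1 e • n) = 0 ∧ T 1 (aug2 e • n) = 0
      · exact ⟨0, X.zero_mem, by rw [sub_zero]; exact hmem n hn hn0.1 hn0.2⟩
      · obtain ⟨h1, h2⟩ := huniq n hn hn0
        exact ⟨m, hα 0, hmem _ (by rw [smul_sub, smul_sub, hn, hm, sub_zero])
          (by rw [smul_sub, map_sub, h1, sub_self]) (by rw [smul_sub, map_sub, h2, sub_self])⟩

end Decomposition

/-! ### Complements among the norm subspaces and the full decomposition. -/

section Decomposition
variable {G : Type*} [Group G] {e : G ≃* Multiplicative (ZMod 2 × ZMod 2)}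
variable {M : Type*} [AddCommGroup M] [Module (ZMod 2)[G] M] [Module (ZMod 2) M]
    [IsScalarTower (ZMod 2) (ZMod 2)[G] M] {U : Submodule (ZMod 2) M}

theorem iSupIndep_of_fixed {M : Type*} [AddCommGroup M] [Module (ZMod 2)[G] M]
    {ι : Type*} [Fintype ι] (S : ι → Submodule (ZMod 2)[G] M)
    (h : ∀ f : ι → M, (∀ i, f i ∈ S i) → (∀ i, aug1 e • f i = 0) → (∀ i, aug2 e • f i = 0) →
      ∑ i, f i = 0 → f = 0) : iSupIndep S := by
  classical
  rw [iSupIndep_iff_finsetSum_eq_zero_imp_eq_zero]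
  intro s v hv hs i hi
  have := congrFun (eq_zero_of_fixed e S h (fun i => if i ∈ s then v i else 0)
    (fun i => by
      split_ifs with hi
      · exact hv i hi
      · exact Submodule.zero_mem _)
    (by rw [Finset.sum_ite_mem, Finset.univ_inter, hs])) i
  simpa [hi] using this

theorem exists_free_copies (C : Submodule (ZMod 2) M)
    (hC : ∀ c ∈ C, ∃ m : M, aug1 e • aug2 e • m = c) :
    ∃ Y : Submodule (ZMod 2)[G] M, IsSumOfCopies (ZMod 2)[G] (PermMod e 0) Y ∧
      (∀ c ∈ C, ∃ m ∈ Y, aug1 e • aug2 e • m = c) ∧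
      ∀ m ∈ Y, aug1 e • m = 0 → aug2 e • m = 0 → m ∈ C := by
  obtain ⟨Y, h1, h2, h3⟩ := exists_perm_copies e 0 C fun c hc => by
    obtain ⟨m, hm⟩ := hC c hc
    refine ⟨m, fun g hg => ?_, (mul_smul _ _ _).trans hm⟩
    rw [Subgroup.mem_bot.1 hg, map_one, one_smul]
  refine ⟨Y, h1, fun c hc => ?_, h3⟩
  obtain ⟨m, hm, -, h⟩ := h2 c hc
  exact ⟨m, hm, (mul_smul _ _ _).symm.trans h⟩

theorem exists_norms1_copies (C : Submodule (ZMod 2) M) (hC : C ≤ norms1 e U) :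
    ∃ Y : Submodule (ZMod 2)[G] M, IsSumOfCopies (ZMod 2)[G] (PermMod e 1) Y ∧
      (∀ c ∈ C, ∃ m ∈ Y, aug1 e • m = c ∧ aug2 e • m = 0) ∧
      ∀ m ∈ Y, aug1 e • m = 0 → aug2 e • m = 0 → m ∈ C := by
  obtain ⟨Y, h1, h2, h3⟩ := exists_perm_copies e 1 C fun c hc => by
    obtain ⟨-, m, hm, hm'⟩ := mem_norms1.1 (hC hc)
    exact ⟨m, forall_mem_zpowers (sigma2_mul_self e) ((of_sigma2_smul_iff e m).2 hm'), hm⟩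
  refine ⟨Y, h1, fun c hc => ?_, h3⟩
  obtain ⟨m, hm, hg, h⟩ := h2 c hc
  exact ⟨m, hm, h, (of_sigma2_smul_iff e m).1 (hg _ (Subgroup.mem_zpowers _))⟩

theorem exists_norms2_copies (C : Submodule (ZMod 2) M) (hC : C ≤ norms2 e U) :
    ∃ Y : Submodule (ZMod 2)[G] M, IsSumOfCopies (ZMod 2)[G] (PermMod e 2) Y ∧
      (∀ c ∈ C, ∃ m ∈ Y, aug1 e • m = 0 ∧ aug2 e • m = c) ∧
      ∀ m ∈ Y, aug1 e • m = 0 → aug2 e • m = 0 → m ∈ C := by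
  obtain ⟨Y, h1, h2, h3⟩ := exists_perm_copies e 2 C fun c hc => by
    obtain ⟨-, m, hm, hm'⟩ := mem_norms2.1 (hC hc)
    exact ⟨m, forall_mem_zpowers (sigma1_mul_self e) ((of_sigma1_smul_iff e m).2 hm), hm'⟩
  refine ⟨Y, h1, fun c hc => ?_, h3⟩
  obtain ⟨m, hm, hg, h⟩ := h2 c hc
  exact ⟨m, hm, (of_sigma1_smul_iff e m).1 (hg _ (Subgroup.mem_zpowers _)), h⟩

theorem exists_norms3_copies (C : Submodule (ZMod 2) M) (hC : C ≤ norms3 e U) :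
    ∃ Y : Submodule (ZMod 2)[G] M, IsSumOfCopies (ZMod 2)[G] (PermMod e 3) Y ∧
      (∀ c ∈ C, ∃ m ∈ Y, aug1 e • m = c ∧ aug2 e • m = c) ∧
      ∀ m ∈ Y, aug1 e • m = 0 → aug2 e • m = 0 → m ∈ C := by
  obtain ⟨Y, h1, h2, h3⟩ := exists_perm_copies e 3 C fun c hc => by
    obtain ⟨-, m, hm, hm'⟩ := mem_norms3.1 (hC hc)
    exact ⟨m, forall_mem_zpowers (sigma12_mul_self e)
      ((of_sigma12_smul_iff e m).2 (hm.trans hm'.symm)), hm⟩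
  refine ⟨Y, h1, fun c hc => ?_, h3⟩
  obtain ⟨m, hm, hg, h⟩ := h2 c hc
  have h' : aug1 e • m = c := h
  exact ⟨m, hm, h', h' ▸ ((of_sigma12_smul_iff e m).1 (hg _ (Subgroup.mem_zpowers _))).symm⟩

theorem exists_fixed_copies (C : Submodule (ZMod 2) M) (hC : C ≤ fixedPart e M) :
    ∃ Y : Submodule (ZMod 2)[G] M, IsSumOfCopies (ZMod 2)[G] (PermMod e 4) Y ∧
      (∀ c ∈ C, c ∈ Y) ∧ ∀ m ∈ Y, aug1 e • m = 0 → aug2 e • m = 0 → m ∈ C := by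
  obtain ⟨Y, h1, h2, h3⟩ := exists_perm_copies e 4 C fun c hc => by
    obtain ⟨k1, k2⟩ := (mem_fixedPart e).1 (hC hc)
    rw [← of_sigma1_smul_iff] at k1
    rw [← of_sigma2_smul_iff] at k2
    refine ⟨c, fun g _ => ?_, one_smul _ _⟩
    rcases eq_of_klein e g with rfl | rfl | rfl | rfl
    · rw [map_one, one_smul]
    · exact k1
    · exact k2
    · rw [map_mul, mul_smul, k2, k1]
  refine ⟨Y, h1, fun c hc => ?_, h3⟩
  obtain ⟨m, hm, -, h⟩ := h2 c hc
  rw [← h, show permTop e 4 = 1 from rfl, one_smul]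
  exact hm

theorem exists_pos_one_copies (C : Submodule (ZMod 2) M) (hC : C ≤ norms1 e U ⊓ norms2 e U) :
    ∃ Y : Submodule (ZMod 2)[G] M, IsSumOfCopies (ZMod 2)[G] (OmegaPos e 1) Y ∧
      (∀ c ∈ C, ∃ m ∈ Y, aug1 e • m = c ∧ aug2 e • m = 0) ∧
      (∀ c ∈ C, ∃ m ∈ Y, aug1 e • m = 0 ∧ aug2 e • m = c) ∧
      ∀ m ∈ Y, aug1 e • m = 0 → aug2 e • m = 0 → m ∈ C := by
  obtain ⟨Y, h1, h2, h3⟩ := exists_pos_copies e 1 C (fun _ => C.subtype) (fun v => by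
    obtain ⟨-, m, k1, k2⟩ := mem_norms1.1 (hC v.2).1
    obtain ⟨-, m', k1', k2'⟩ := mem_norms2.1 (hC v.2).2
    refine ⟨![m, m'], fun j => ?_, k1', fun j => ?_, k2⟩
    · fin_cases j; exact k1
    · fin_cases j; exact k2') (fun v hv => by
      funext j
      fin_cases j
      simpa using hv)
  refine ⟨Y, h1, fun c hc => ?_, fun c hc => ?_, fun m hm k1 k2 => ?_⟩
  · obtain ⟨γ, hγ, hr⟩ := h2 ⟨c, hc⟩
    exact ⟨γ 0, hγ 0, hr.aug1_castSucc 0, hr.aug2_zero⟩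
  · obtain ⟨γ, hγ, hr⟩ := h2 ⟨c, hc⟩
    exact ⟨γ 1, hγ 1, hr.aug1_last, hr.aug2_succ 0⟩
  · obtain ⟨v, rfl⟩ := h3 m hm k1 k2
    simp

theorem exists_pos_two_copies (E : Submodule (ZMod 2) M) (hE : E ≤ norms3 e U)
    (p q : E →ₗ[ZMod 2] M) (hp : ∀ v, p v ∈ norms1 e U) (hq : ∀ v, q v ∈ norms2 e U)
    (hpq : ∀ v, p v + q v = v) (hinj : ∀ v w, p v + q w = 0 → v = 0 ∧ w = 0) :
    ∃ Y : Submodule (ZMod 2)[G] M, IsSumOfCopies (ZMod 2)[G] (OmegaPos e 2) Y ∧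
      (∀ v, ∃ m ∈ Y, aug1 e • m = p v ∧ aug2 e • m = 0) ∧
      (∀ v, ∃ m ∈ Y, aug1 e • m = 0 ∧ aug2 e • m = q v) ∧
      (∀ v : E, ∃ m ∈ Y, aug1 e • m = v ∧ aug2 e • m = v) ∧
      ∀ m ∈ Y, aug1 e • m = 0 → aug2 e • m = 0 → ∃ v w, m = p v + q w := by
  obtain ⟨Y, h1, h2, h3⟩ := exists_pos_copies e 2 E ![p, q] (fun v => by
    obtain ⟨-, m1, k1, k1'⟩ := mem_norms1.1 (hp v)
    obtain ⟨-, m2, k2, k2'⟩ := mem_norms2.1 (hq v)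
    obtain ⟨-, m3, k3, k3'⟩ := mem_norms3.1 (hE v.2)
    -- The lifts m1, m2, m3 have values (p, 0), (0, q), (p + q, p + q) under (a₁, a₂), so the middle
    -- generator has value (q, p), which is the relation of Ω².
    refine ⟨![m1, m3 - m1 - m2, m2], fun j => ?_, k2, fun j => ?_, k1'⟩
    · fin_cases j
      · exact k1
      · change aug1 e • (m3 - m1 - m2) = q v
        rw [smul_sub, smul_sub, k1, k2, k3, ← hpq]; abel
    · fin_cases j
      · change aug2 e • (m3 - m1 - m2) = p v
        rw [smul_sub, smul_sub, k1', k2', k3', ← hpq]; abel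
      · exact k2') (fun v hv => by
      rw [Fin.sum_univ_two] at hv
      obtain ⟨h0, h1⟩ := hinj _ _ hv
      funext j
      fin_cases j
      · exact h0
      · exact h1)
  refine ⟨Y, h1, fun v => ?_, fun v => ?_, fun v => ?_, fun m hm k1 k2 => ?_⟩
  · obtain ⟨γ, hγ, hr⟩ := h2 v
    exact ⟨γ 0, hγ 0, hr.aug1_castSucc 0, hr.aug2_zero⟩
  · obtain ⟨γ, hγ, hr⟩ := h2 v
    exact ⟨γ 2, hγ 2, hr.aug1_last, hr.aug2_succ 1⟩
  · obtain ⟨γ, hγ, hr⟩ := h2 v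
    refine ⟨γ 0 + γ 1 + γ 2, Y.add_mem (Y.add_mem (hγ 0) (hγ 1)) (hγ 2), ?_, ?_⟩
    · rw [smul_add, smul_add]
      refine (congrArg₂ (· + ·) (congrArg₂ (· + ·) (hr.aug1_castSucc 0) (hr.aug1_castSucc 1))
        hr.aug1_last).trans ?_
      simpa using hpq v
    · rw [smul_add, smul_add]
      refine (congrArg₂ (· + ·) (congrArg₂ (· + ·) hr.aug2_zero (hr.aug2_succ 0))
        (hr.aug2_succ 1)).trans ?_
      simpa using hpq v
  · obtain ⟨v, rfl⟩ := h3 m hm k1 k2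
    exact ⟨v 0, v 1, Fin.sum_univ_two _⟩

/-- The complements are chosen so that the fixed parts of all summands form a direct sum, which
yields independence. Spanning follows by climbing the chain: fixed elements, elements sent into U by
a₁ and a₂, ker(a₁a₂), everything. -/
theorem exists_decomposition (T : Fin 3 → M →ₗ[ZMod 2] ZMod 2)
    (hTU : ∀ m, aug1 e • m = 0 → aug2 e • m = 0 → (m ∈ U ↔ ∀ i, T i m = 0))
    (hU1 : ∀ u ∈ U, aug1 e • u = 0) (hU2 : ∀ u ∈ U, aug2 e • u = 0)
    (hU12 : ∀ m, aug1 e • aug2 e • m ∈ U)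
    (hT : ∀ m, aug1 e • aug2 e • m = 0 → T 1 (aug1 e • m) = 0 ∧ T 0 (aug2 e • m) = 0 ∧
      T 2 (aug1 e • m) = T 0 (aug1 e • m) + T 1 (aug2 e • m) ∧
      T 2 (aug2 e • m) = T 0 (aug1 e • m) + T 1 (aug2 e • m))
    (hS : ∀ m, aug1 e • m ∈ U → aug2 e • m ∈ U → ∃ c ∈ norms1 e U, ∃ d ∈ norms2 e U,
      aug1 e • m + c = aug2 e • m + d) :
    ∃ (X : Submodule (ZMod 2)[G] M) (Y : Fin 5 → Submodule (ZMod 2)[G] M)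
      (Z : Fin 2 → Submodule (ZMod 2)[G] M),
      DirectSum.IsInternal (Sum.elim (fun _ : Unit => X) (Sum.elim Y Z)) ∧
      IsExceptional e X ∧ (∀ i : Fin 5, IsSumOfCopies (ZMod 2)[G] (PermMod e i) (Y i)) ∧
      IsSumOfCopies (ZMod 2)[G] (OmegaPos e 1) (Z 0) ∧
      IsSumOfCopies (ZMod 2)[G] (OmegaPos e 2) (Z 1) := by
  obtain ⟨X, hX, hXfix, hXker⟩ := exists_exceptional T hTU hU1 hU2 hT
  -- the subspaces of `U`
  let W00 : Submodule (ZMod 2) M := LinearMap.range (actMap M (aug1 e * aug2 e))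
  have hW00 : ∀ w, w ∈ W00 ↔ ∃ m, aug1 e • aug2 e • m = w := fun w => by
    simp only [W00, LinearMap.mem_range, actMap_apply, mul_smul]
  have hW00le : W00 ≤ norms1 e U ⊓ norms2 e U := by
    intro w hw
    obtain ⟨m, rfl⟩ := (hW00 w).1 hw
    exact ⟨mem_norms1.2 ⟨hU12 m, aug2 e • m, rfl, aug2_aug2 e m⟩,
      mem_norms2.2 ⟨hU12 m, aug1 e • m, aug1_aug1 e m, aug2_aug1 e m⟩⟩
  obtain ⟨C0, hC0, hC0d, hC0s⟩ := exists_complement_of_le hW00le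
  have hW0le : norms1 e U ⊓ norms2 e U ≤ norms3 e U ⊓ (norms1 e U ⊔ norms2 e U) :=
    le_inf norms1_inf_norms2_le (inf_le_left.trans le_sup_left)
  obtain ⟨E, hE, hEd, hEs⟩ := exists_complement_of_le hW0le
  obtain ⟨p, q, hp, hq, hpq⟩ := exists_splitting (hE.trans inf_le_right)
  -- If p v also lies in N₂, so does v = p v + q v. As v is in N₃ it then lies in N₁ as well,
  -- whereas E meets N₁ ∩ N₂ trivially.
  have hpinj : ∀ v, p v ∈ norms2 e U → v = 0 := by
    intro v hv
    have hv2 : (v : M) ∈ norms2 e U := by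
      rw [← hpq]; exact Submodule.add_mem _ hv (hq v)
    have hv3 := (hE v.2).1
    exact Subtype.ext (hEd v ⟨norms2_inf_norms3_le ⟨hv2, hv3⟩, hv2⟩ v.2)
  have hqinj : ∀ v, q v ∈ norms1 e U → v = 0 := by
    intro v hv
    have hv1 : (v : M) ∈ norms1 e U := by
      rw [← hpq]; exact Submodule.add_mem _ (hp v) hv
    have hv3 := (hE v.2).1
    exact Subtype.ext (hEd v ⟨hv1, norms1_inf_norms3_le ⟨hv1, hv3⟩⟩ v.2)
  have hpqinj : ∀ v w, p v + q w = 0 → v = 0 ∧ w = 0 := by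
    intro v w h
    refine ⟨hpinj v ?_, hqinj w ?_⟩
    · rw [eq_neg_of_add_eq_zero_left h]; exact Submodule.neg_mem _ (hq w)
    · rw [eq_neg_of_add_eq_zero_right h]; exact Submodule.neg_mem _ (hp v)
  obtain ⟨C1, hC1, hC1d, hC1s⟩ := exists_complement_of_le
    (show (norms1 e U ⊓ norms2 e U) ⊔ LinearMap.range p ≤ norms1 e U from
      sup_le inf_le_left (by rintro _ ⟨v, rfl⟩; exact hp v))
  obtain ⟨C2, hC2, hC2d, hC2s⟩ := exists_complement_of_le
    (show (norms1 e U ⊓ norms2 e U) ⊔ LinearMap.range q ≤ norms2 e U from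
      sup_le inf_le_right (by rintro _ ⟨v, rfl⟩; exact hq v))
  obtain ⟨C3, hC3, hC3d, hC3s⟩ := exists_complement_of_le
    (show norms3 e U ⊓ (norms1 e U ⊔ norms2 e U) ≤ norms3 e U from inf_le_left)
  have hUfix : U ≤ fixedPart e M := fun u hu => (mem_fixedPart e).2 ⟨hU1 u hu, hU2 u hu⟩
  obtain ⟨C4, hC4, hC4d, hC4s⟩ := exists_complement_of_le
    (show normsSup e U ⊔ (X.restrictScalars (ZMod 2) ⊓ fixedPart e M) ≤ fixedPart e M from
      sup_le (normsSup_le.trans hUfix) inf_le_right)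
  -- the summands
  obtain ⟨Y0, hY0, hY0g, hY0f⟩ := exists_free_copies (e := e) W00 fun c hc => (hW00 c).1 hc
  obtain ⟨Y1, hY1, hY1g, hY1f⟩ := exists_norms1_copies C1 hC1
  obtain ⟨Y2, hY2, hY2g, hY2f⟩ := exists_norms2_copies C2 hC2
  obtain ⟨Y3, hY3, hY3g, hY3f⟩ := exists_norms3_copies C3 hC3
  obtain ⟨Y4, hY4, hY4g, hY4f⟩ := exists_fixed_copies C4 hC4
  obtain ⟨Z1, hZ1, hZ1g, hZ1g', hZ1f⟩ := exists_pos_one_copies C0 hC0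
  obtain ⟨Z2, hZ2, hZ2g, hZ2g', hZ2g'', hZ2f⟩ := exists_pos_two_copies E
    (hE.trans inf_le_left) p q hp hq hpq hpqinj
  refine ⟨X, ![Y0, Y1, Y2, Y3, Y4], ![Z1, Z2], ?_, hX, ?_, hZ1, hZ2⟩
  swap
  · intro i
    fin_cases i
    exacts [hY0, hY1, hY2, hY3, hY4]
  classical
  rw [DirectSum.isInternal_submodule_iff_iSupIndep_and_iSup_eq_top]
  constructor
  · refine iSupIndep_of_fixed (e := e) _ fun f hf h1 h2 hs => ?_
    have hx := hf (Sum.inl ())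
    have hx' := hXfix _ hx (h1 _) (h2 _)
    have hxF := (mem_fixedPart e).2 ⟨h1 (Sum.inl ()), h2 (Sum.inl ())⟩
    have hy0 := hY0f _ (hf (Sum.inr (Sum.inl 0))) (h1 _) (h2 _)
    have hy1 := hY1f _ (hf (Sum.inr (Sum.inl 1))) (h1 _) (h2 _)
    have hy2 := hY2f _ (hf (Sum.inr (Sum.inl 2))) (h1 _) (h2 _)
    have hy3 := hY3f _ (hf (Sum.inr (Sum.inl 3))) (h1 _) (h2 _)
    have hy4 := hY4f _ (hf (Sum.inr (Sum.inl 4))) (h1 _) (h2 _)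
    have hz1 := hZ1f _ (hf (Sum.inr (Sum.inr 0))) (h1 _) (h2 _)
    obtain ⟨v, w, hz2⟩ := hZ2f _ (hf (Sum.inr (Sum.inr 1))) (h1 _) (h2 _)
    simp only [Fintype.sum_sum_type, Finset.univ_unique, Finset.sum_singleton, Fin.sum_univ_five,
      Fin.sum_univ_two, PUnit.default_eq_unit] at hs
    suffices f (Sum.inl ()) = 0 ∧ f (Sum.inr (Sum.inl 0)) = 0 ∧ f (Sum.inr (Sum.inl 1)) = 0 ∧
        f (Sum.inr (Sum.inl 2)) = 0 ∧ f (Sum.inr (Sum.inl 3)) = 0 ∧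
        f (Sum.inr (Sum.inl 4)) = 0 ∧ f (Sum.inr (Sum.inr 0)) = 0 ∧
        f (Sum.inr (Sum.inr 1)) = 0 by
      obtain ⟨a, b0, b1, b2, b3, b4, c0, c1⟩ := this
      funext i
      rcases i with i | i | i
      · exact a
      · fin_cases i
        exacts [b0, b1, b2, b3, b4]
      · fin_cases i
        exacts [c0, c1]
    generalize f (Sum.inl ()) = x at *
    generalize f (Sum.inr (Sum.inl 0)) = y0 at *
    generalize f (Sum.inr (Sum.inl 1)) = y1 at *
    generalize f (Sum.inr (Sum.inl 2)) = y2 at *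
    generalize f (Sum.inr (Sum.inl 3)) = y3 at *
    generalize f (Sum.inr (Sum.inl 4)) = y4 at *
    generalize f (Sum.inr (Sum.inr 0)) = z1 at *
    generalize f (Sum.inr (Sum.inr 1)) = z2 at *
    subst hz2
    have i1 : y0 ∈ norms1 e U ⊓ norms2 e U := hW00le hy0
    have i2 : z1 ∈ norms1 e U ⊓ norms2 e U := hC0 hz1
    have n1 : norms1 e U ≤ norms1 e U ⊔ norms2 e U := le_sup_left
    have n2 : norms2 e U ≤ norms1 e U ⊔ norms2 e U := le_sup_right
    have s12 : y0 + y1 + y2 + z1 + (p v + q w) ∈ norms1 e U ⊔ norms2 e U :=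
      Submodule.add_mem _ (Submodule.add_mem _ (Submodule.add_mem _ (Submodule.add_mem _
        (n1 i1.1) (n1 (hC1 hy1))) (n2 (hC2 hy2))) (n1 i2.1))
        (Submodule.add_mem _ (n1 (hp v)) (n2 (hq w)))
    have s123 : y0 + y1 + y2 + z1 + (p v + q w) + y3 ∈ normsSup e U :=
      Submodule.add_mem _ (Submodule.mem_sup_left s12) (Submodule.mem_sup_right (hC3 hy3))
    have r4 : y4 = 0 := by
      refine hC4d _ ?_ hy4
      have : y4 = -(y0 + y1 + y2 + z1 + (p v + q w) + y3 + x) := by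
        rw [eq_neg_iff_add_eq_zero, ← hs]; abel
      rw [this]
      exact Submodule.neg_mem _ (Submodule.add_mem _ (Submodule.mem_sup_left s123)
        (Submodule.mem_sup_right ⟨hx, hxF⟩))
    subst r4
    have rx : x = 0 := by
      refine hx' ?_
      have : x = -(y0 + y1 + y2 + z1 + (p v + q w) + y3) := by
        rw [eq_neg_iff_add_eq_zero, ← hs]; abel
      rw [this]
      exact Submodule.neg_mem _ s123
    subst rx
    have r3 : y3 = 0 := by
      refine hC3d _ ⟨hC3 hy3, ?_⟩ hy3
      have : y3 = -(y0 + y1 + y2 + z1 + (p v + q w)) := by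
        rw [eq_neg_iff_add_eq_zero, ← hs]; abel
      rw [this]
      exact Submodule.neg_mem _ s12
    subst r3
    have m1 : y0 + z1 + p v + y1 ∈ norms1 e U := Submodule.add_mem _ (Submodule.add_mem _
      (Submodule.add_mem _ i1.1 i2.1) (hp v)) (hC1 hy1)
    have m2 : q w + y2 ∈ norms2 e U := Submodule.add_mem _ (hq w) (hC2 hy2)
    have m12 : q w + y2 = -(y0 + z1 + p v + y1) := by
      rw [eq_neg_iff_add_eq_zero, ← hs]; abel
    -- Being the negative of an element of N₁, the N₂-part lies in the intersection, and the choice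
    -- of C₂ and C₁ kills y2 and y1.
    have mm : q w + y2 ∈ norms1 e U ⊓ norms2 e U := ⟨m12 ▸ Submodule.neg_mem _ m1, m2⟩
    have r2 : y2 = 0 := by
      refine hC2d _ ?_ hy2
      rw [← add_sub_cancel_left (q w) y2]
      exact Submodule.sub_mem _ (Submodule.mem_sup_left mm) (Submodule.mem_sup_right ⟨w, rfl⟩)
    have r1 : y1 = 0 := by
      refine hC1d _ ?_ hy1
      have : y1 = -(q w + y2) - (y0 + z1) - p v := by rw [m12]; abel
      rw [this]
      exact Submodule.sub_mem _ (Submodule.sub_mem _ (Submodule.neg_mem _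
        (Submodule.mem_sup_left mm)) (Submodule.mem_sup_left (Submodule.add_mem _ i1 i2)))
        (Submodule.mem_sup_right ⟨v, rfl⟩)
    subst r1 r2
    have rw0 : w = 0 := hqinj w (by rw [← add_zero (q w)]; exact mm.1)
    subst rw0
    have rv0 : v = 0 := by
      refine hpinj v ?_
      have : p v = -(y0 + z1) := by
        rw [eq_neg_iff_add_eq_zero, ← hs, map_zero]; abel
      rw [this]
      exact Submodule.neg_mem _ (Submodule.add_mem _ i1.2 i2.2)
    subst rv0
    have r0 : z1 = 0 := by
      refine hC0d _ ?_ hz1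
      have : z1 = -y0 := by
        rw [eq_neg_iff_add_eq_zero, ← hs, map_zero, map_zero]; abel
      rw [this]
      exact Submodule.neg_mem _ hy0
    subst r0
    simpa using hs
  · set S := ⨆ i, Sum.elim (fun _ : Unit => X) (Sum.elim ![Y0, Y1, Y2, Y3, Y4] ![Z1, Z2]) i with hSd
    have hle : ∀ i, Sum.elim (fun _ : Unit => X) (Sum.elim ![Y0, Y1, Y2, Y3, Y4] ![Z1, Z2]) i ≤ S :=
      fun i => le_iSup _ i
    have hXS : X ≤ S := hle (Sum.inl ())
    have hY0S : Y0 ≤ S := hle (Sum.inr (Sum.inl 0))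
    have hY1S : Y1 ≤ S := hle (Sum.inr (Sum.inl 1))
    have hY2S : Y2 ≤ S := hle (Sum.inr (Sum.inl 2))
    have hY3S : Y3 ≤ S := hle (Sum.inr (Sum.inl 3))
    have hY4S : Y4 ≤ S := hle (Sum.inr (Sum.inl 4))
    have hZ1S : Z1 ≤ S := hle (Sum.inr (Sum.inr 0))
    have hZ2S : Z2 ≤ S := hle (Sum.inr (Sum.inr 1))
    clear_value S
    have lift01 : ∀ w ∈ norms1 e U ⊓ norms2 e U, ∃ m ∈ S, aug1 e • m = w ∧ aug2 e • m = 0 := by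
      intro w hw
      obtain ⟨a, ha, c, hc, rfl⟩ := hC0s w hw
      obtain ⟨m, hm, rfl⟩ := hY0g a ha
      obtain ⟨m', hm', k1, k2⟩ := hZ1g c hc
      refine ⟨aug2 e • m + m', S.add_mem (S.smul_mem _ (hY0S hm)) (hZ1S hm'), ?_, ?_⟩
      · rw [smul_add, k1]
      · rw [smul_add, k2, aug2_aug2, add_zero]
    have lift02 : ∀ w ∈ norms1 e U ⊓ norms2 e U, ∃ m ∈ S, aug1 e • m = 0 ∧ aug2 e • m = w := by
      intro w hw
      obtain ⟨a, ha, c, hc, rfl⟩ := hC0s w hw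
      obtain ⟨m, hm, rfl⟩ := hY0g a ha
      obtain ⟨m', hm', k1, k2⟩ := hZ1g' c hc
      refine ⟨aug1 e • m + m', S.add_mem (S.smul_mem _ (hY0S hm)) (hZ1S hm'), ?_, ?_⟩
      · rw [smul_add, k1, aug1_aug1, add_zero]
      · rw [smul_add, k2, aug2_aug1]
    have lift1 : ∀ w ∈ norms1 e U, ∃ m ∈ S, aug1 e • m = w ∧ aug2 e • m = 0 := by
      intro w hw
      obtain ⟨a, ha, c, hc, rfl⟩ := hC1s w hw
      obtain ⟨b, hb, _, ⟨v, rfl⟩, rfl⟩ := Submodule.mem_sup.1 ha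
      obtain ⟨m1, hm1, k1, k1'⟩ := lift01 b hb
      obtain ⟨m2, hm2, k2, k2'⟩ := hZ2g v
      obtain ⟨m3, hm3, k3, k3'⟩ := hY1g c hc
      refine ⟨m1 + m2 + m3, S.add_mem (S.add_mem hm1 (hZ2S hm2)) (hY1S hm3), ?_, ?_⟩
      · rw [smul_add, smul_add, k1, k2, k3]
      · rw [smul_add, smul_add, k1', k2', k3', add_zero, add_zero]
    have lift2 : ∀ w ∈ norms2 e U, ∃ m ∈ S, aug1 e • m = 0 ∧ aug2 e • m = w := by
      intro w hw
      obtain ⟨a, ha, c, hc, rfl⟩ := hC2s w hw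
      obtain ⟨b, hb, _, ⟨v, rfl⟩, rfl⟩ := Submodule.mem_sup.1 ha
      obtain ⟨m1, hm1, k1, k1'⟩ := lift02 b hb
      obtain ⟨m2, hm2, k2, k2'⟩ := hZ2g' v
      obtain ⟨m3, hm3, k3, k3'⟩ := hY2g c hc
      refine ⟨m1 + m2 + m3, S.add_mem (S.add_mem hm1 (hZ2S hm2)) (hY2S hm3), ?_, ?_⟩
      · rw [smul_add, smul_add, k1, k2, k3, add_zero, add_zero]
      · rw [smul_add, smul_add, k1', k2', k3']
    -- The component b in N₁ ∩ N₂ is lifted twice, with values (b, 0) and (0, b), whose sum has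
    -- value (b, b).
    have lift3 : ∀ w ∈ norms3 e U, ∃ m ∈ S, aug1 e • m = w ∧ aug2 e • m = w := by
      intro w hw
      obtain ⟨a, ha, c, hc, rfl⟩ := hC3s w hw
      obtain ⟨b, hb, v, hv, rfl⟩ := hEs a ha
      obtain ⟨m1, hm1, k1, k1'⟩ := lift01 b hb
      obtain ⟨m1', hm1', j1, j1'⟩ := lift02 b hb
      obtain ⟨m2, hm2, k2, k2'⟩ := hZ2g'' ⟨v, hv⟩
      obtain ⟨m3, hm3, k3, k3'⟩ := hY3g c hc
      refine ⟨m1 + m1' + m2 + m3,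
        S.add_mem (S.add_mem (S.add_mem hm1 hm1') (hZ2S hm2)) (hY3S hm3), ?_, ?_⟩
      · rw [smul_add, smul_add, smul_add, k1, j1, k2, k3, add_zero]
      · rw [smul_add, smul_add, smul_add, k1', j1', k2', k3', zero_add]
    have hsup : ∀ w ∈ normsSup e U, w ∈ S := by
      intro w hw
      obtain ⟨w', hw', w3, hw3, rfl⟩ := Submodule.mem_sup.1 hw
      obtain ⟨w1, hw1, w2, hw2, rfl⟩ := Submodule.mem_sup.1 hw'
      obtain ⟨m1, hm1, rfl, -⟩ := lift1 w1 hw1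
      obtain ⟨m2, hm2, -, rfl⟩ := lift2 w2 hw2
      obtain ⟨m3, hm3, rfl, -⟩ := lift3 w3 hw3
      exact S.add_mem (S.add_mem (S.smul_mem _ hm1) (S.smul_mem _ hm2)) (S.smul_mem _ hm3)
    have hfix : ∀ m, aug1 e • m = 0 → aug2 e • m = 0 → m ∈ S := by
      intro m h1 h2
      obtain ⟨a, ha, c, hc, rfl⟩ := hC4s m ((mem_fixedPart e).2 ⟨h1, h2⟩)
      obtain ⟨w, hw, x, hx, rfl⟩ := Submodule.mem_sup.1 ha
      exact S.add_mem (S.add_mem (hsup w hw) (hXS hx.1)) (hY4S (hY4g c hc))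
    -- After adding lifts of the norms c and d supplied by `hS`, the values under a₁ and a₂
    -- coincide, giving an element of N₃. Subtracting its lift leaves a fixed element.
    have hUU : ∀ m, aug1 e • m ∈ U → aug2 e • m ∈ U → m ∈ S := by
      intro m h1 h2
      obtain ⟨c, hc, d, hd, hcd⟩ := hS m h1 h2
      obtain ⟨m1, hm1, k1, k1'⟩ := lift1 c hc
      obtain ⟨m2, hm2, k2, k2'⟩ := lift2 d hd
      have h3 : aug1 e • m + c ∈ norms3 e U := mem_norms3.2 ⟨U.add_mem h1 hc.2, m + m1 + m2,
        by rw [smul_add, smul_add, k1, k2, add_zero],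
        by rw [smul_add, smul_add, k1', k2', add_zero, hcd]⟩
      obtain ⟨m3, hm3, k3, k3'⟩ := lift3 _ h3
      have : m - (m3 - m1 - m2) ∈ S := by
        apply hfix
        · simp only [smul_sub, k1, k2, k3]; abel
        · simp only [smul_sub, k1', k2', k3', hcd]; abel
      simpa using S.add_mem this (S.sub_mem (S.sub_mem hm3 hm1) hm2)
    have hker : ∀ m, aug1 e • aug2 e • m = 0 → m ∈ S := by
      intro m hm
      obtain ⟨ξ, hξ, h1, h2⟩ := hXker m hm
      simpa using S.add_mem (hUU _ h1 h2) (hXS hξ)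
    rw [eq_top_iff]
    rintro m -
    obtain ⟨m', hm', h⟩ := hY0g (aug1 e • aug2 e • m) ((hW00 _).2 ⟨m, rfl⟩)
    have : m - m' ∈ S := hker _ (by rw [smul_sub, smul_sub, h, sub_self])
    simpa using S.add_mem this (hY0S hm')

end Decomposition

/-! ### Indecomposability of the nine modules. -/

section Indecomposable
variable {G : Type*} [Group G] (e : G ≃* Multiplicative (ZMod 2 × ZMod 2))

section General
variable {M : Type*} [AddCommGroup M] [Module (ZMod 2)[G] M]

theorem exists_fixed_ne_zero {A : Submodule (ZMod 2)[G] M} (hA : A ≠ ⊥) :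
    ∃ m ∈ A, m ≠ 0 ∧ aug1 e • m = 0 ∧ aug2 e • m = 0 := by
  by_contra! h
  refine hA ((Submodule.eq_bot_iff A).2 fun m hm => ?_)
  have key : ∀ n ∈ A, aug1 e • n = 0 → aug2 e • n = 0 → n = 0 := fun n hn h1 h2 => by
    by_contra h0
    exact h n hn h0 h1 h2
  have h12 : aug1 e • aug2 e • m = 0 := key _ (A.smul_mem _ (A.smul_mem _ hm)) (by simp)
    (by rw [aug2_aug1]; simp)
  exact key m hm (key _ (A.smul_mem _ hm) (by simp) (by rw [aug2_aug1, h12]))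
    (key _ (A.smul_mem _ hm) h12 (by simp))

/-- Two nonzero summands would each contain a nonzero fixed element, and only one is available. -/
theorem isIndecomposable_of_fixed (b : M) (hb : b ≠ 0)
    (h : ∀ m : M, aug1 e • m = 0 → aug2 e • m = 0 → m = 0 ∨ m = b) :
    IsIndecomposable (ZMod 2)[G] M := by
  refine ⟨⟨⟨b, 0, hb⟩⟩, fun A B hAB => ?_⟩
  by_contra! hne
  obtain ⟨a, ha, ha0, h1, h2⟩ := exists_fixed_ne_zero e hne.1
  obtain ⟨c, hc, hc0, k1, k2⟩ := exists_fixed_ne_zero e hne.2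
  have e1 := (h a h1 h2).resolve_left ha0
  have e2 := (h c k1 k2).resolve_left hc0
  exact ha0 (Submodule.disjoint_def.1 hAB.disjoint a ha (by rw [e1, ← e2]; exact hc))

end General

theorem isIndecomposable_permMod (i : Fin 5) : IsIndecomposable (ZMod 2)[G] (PermMod e i) :=
  isIndecomposable_of_fixed e _ (permTop_ne_zero e i)
    (permMod_fixed e i _ (permTop_ne_zero e i) (aug1_permTop e i) (aug2_permTop e i))

section TwoStep
variable {V W : Type*} [AddCommGroup V] [Module (ZMod 2) V] [AddCommGroup W]
    [Module (ZMod 2) W] (A B : V →ₗ[ZMod 2] W)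

theorem aug_comb_tsMk (c d : ZMod 2) (v : V) (w : W) :
    ∃ r : (ZMod 2)[G], r • tsMk e A B v w = tsMk e A B 0 (c • A v + d • B v) := by
  refine ⟨c • aug1 e + d • aug2 e, ?_⟩
  rw [add_smul, smul_assoc, smul_assoc, aug1_tsMk, aug2_tsMk, tsMk_smul, tsMk_smul, tsMk_add]
  simp

/-- If the submodules of `twoStep e A B` generated by elements outside the second factor meet
pairwise and the second factor is generated by the images of `A` and `B`, then the module is
indecomposable. -/
theorem isIndecomposable_of_meet [Nontrivial V]
    (hmeet : ∀ v v' : V, v ≠ 0 → v' ≠ 0 → ∃ c d c' d' : ZMod 2,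
      c • A v + d • B v = c' • A v' + d' • B v' ∧ c • A v + d • B v ≠ 0)
    (hspan : ∀ w : W, ∃ v v' : V, w = A v + B v') :
    IsIndecomposable (ZMod 2)[G] (twoStep e A B).asModule := by
  -- If S' lies inside W, then S projects onto V, so it contains all A v and B v, hence W, hence S';
  -- disjointness gives S' = 0.
  have main : ∀ S S' : Submodule (ZMod 2)[G] (twoStep e A B).asModule, IsCompl S S' →
      (∀ v w, tsMk e A B v w ∈ S' → v = 0) → S' = ⊥ := by
    intro S S' hS h
    have hv : ∀ v, ∃ w, tsMk e A B v w ∈ S := by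
      intro v
      obtain ⟨a, ha, b, hb, hab⟩ := Submodule.mem_sup.1
        (show tsMk e A B v 0 ∈ S ⊔ S' by rw [hS.sup_eq_top]; trivial)
      obtain ⟨v1, w1, rfl⟩ := exists_tsMk e A B a
      obtain ⟨v2, w2, rfl⟩ := exists_tsMk e A B b
      rw [h _ _ hb, tsMk_add, tsMk_inj, add_zero] at hab
      exact ⟨w1, hab.1 ▸ ha⟩
    have hw : ∀ w, tsMk e A B 0 w ∈ S := by
      intro w
      obtain ⟨v, v', rfl⟩ := hspan w
      obtain ⟨w1, h1⟩ := hv v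
      obtain ⟨w2, h2⟩ := hv v'
      have := S.add_mem (S.smul_mem (aug1 e) h1) (S.smul_mem (aug2 e) h2)
      rwa [aug1_tsMk, aug2_tsMk, tsMk_add, add_zero] at this
    refine (Submodule.eq_bot_iff _).2 fun m hm => ?_
    obtain ⟨v, w, rfl⟩ := exists_tsMk e A B m
    obtain rfl := h _ _ hm
    exact Submodule.disjoint_def.1 hS.disjoint _ (hw w) hm
  obtain ⟨v, hv⟩ := exists_ne (0 : V)
  refine ⟨⟨⟨tsMk e A B v 0, 0, fun h => hv ((tsMk_eq_zero e A B).1 h).1⟩⟩, fun S S' hS => ?_⟩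
  by_cases h1 : ∀ v w, tsMk e A B v w ∈ S' → v = 0
  · exact Or.inr (main S S' hS h1)
  by_cases h2 : ∀ v w, tsMk e A B v w ∈ S → v = 0
  · exact Or.inl (main S' S hS.symm h2)
  push Not at h1 h2
  obtain ⟨v1, w1, m1, n1⟩ := h1
  obtain ⟨v2, w2, m2, n2⟩ := h2
  obtain ⟨c, d, c', d', heq, hne⟩ := hmeet v1 v2 n1 n2
  obtain ⟨r, hr⟩ := aug_comb_tsMk e A B c d v1 w1
  obtain ⟨r', hr'⟩ := aug_comb_tsMk e A B c' d' v2 w2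
  have k1 := S'.smul_mem r m1
  have k2 := S.smul_mem r' m2
  rw [hr] at k1
  rw [hr', ← heq] at k2
  exact absurd ((tsMk_eq_zero e A B).1 (Submodule.disjoint_def.1 hS.disjoint _ k2 k1)).2 hne

/-- A criterion for indecomposability when the second factor has dimension two and contains all
fixed elements. -/
theorem isIndecomposable_of_separated [Nontrivial W]
    (hAB : ∀ v, A v = 0 → B v = 0 → v = 0)
    (hW : ∀ w w' u : W, w ≠ 0 → w' ≠ 0 → w ≠ w' → u = 0 ∨ u = w ∨ u = w' ∨ u = w + w')
    (hsep : ∀ w w' : W, w ≠ 0 → w' ≠ 0 → w ≠ w' → ∃ v, ∀ v1 v2,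
      (A v1 = 0 ∨ A v1 = w) → (B v1 = 0 ∨ B v1 = w) → (A v2 = 0 ∨ A v2 = w') →
      (B v2 = 0 ∨ B v2 = w') → v1 + v2 ≠ v) :
    IsIndecomposable (ZMod 2)[G] (twoStep e A B).asModule := by
  obtain ⟨w0, hw0⟩ := exists_ne (0 : W)
  refine ⟨⟨⟨tsMk e A B 0 w0, 0, fun h => hw0 ((tsMk_eq_zero e A B).1 h).2⟩⟩, fun S S' hS => ?_⟩
  by_contra! hne
  obtain ⟨a, ha, ha0, h1, h2⟩ := exists_fixed_ne_zero e hne.1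
  obtain ⟨c, hc, hc0, k1, k2⟩ := exists_fixed_ne_zero e hne.2
  obtain ⟨w, rfl⟩ := tsMk_mem_of_fixed hAB a h1 h2
  obtain ⟨w', rfl⟩ := tsMk_mem_of_fixed hAB c k1 k2
  have hw : w ≠ 0 := fun h => ha0 (by rw [h, tsMk_zero])
  have hw' : w' ≠ 0 := fun h => hc0 (by rw [h, tsMk_zero])
  have hdis : ∀ u, tsMk e A B 0 u ∈ S → tsMk e A B 0 u ∈ S' → u = 0 := fun u hu hu' =>
    ((tsMk_eq_zero e A B).1 (Submodule.disjoint_def.1 hS.disjoint _ hu hu')).2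
  have hww : w ≠ w' := fun h => hw (hdis w ha (h ▸ hc))
  -- W is the plane spanned by w and w'. Since w' is in S', the submodule S can meet W only in the
  -- line through w.
  have hsub : ∀ u, tsMk e A B 0 u ∈ S → u = 0 ∨ u = w := by
    intro u hu
    rcases hW w w' u hw hw' hww with h | rfl | rfl | rfl
    · exact Or.inl h
    · exact Or.inr rfl
    · exact absurd (hdis _ hu hc) hw'
    · have := S.sub_mem hu ha
      refine absurd (hdis w' ?_ hc) hw'
      have e1 : tsMk e A B 0 w' = tsMk e A B 0 (w + w') - tsMk e A B 0 w := by
        rw [eq_sub_iff_add_eq, tsMk_add, tsMk_inj]; exact ⟨add_zero _, add_comm _ _⟩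
      rwa [e1]
  have hsub' : ∀ u, tsMk e A B 0 u ∈ S' → u = 0 ∨ u = w' := by
    intro u hu
    rcases hW w w' u hw hw' hww with h | rfl | rfl | rfl
    · exact Or.inl h
    · exact absurd (hdis _ ha hu) hw
    · exact Or.inr rfl
    · have := S'.sub_mem hu hc
      refine absurd (hdis w ha ?_) hw
      have e1 : tsMk e A B 0 w = tsMk e A B 0 (w + w') - tsMk e A B 0 w' := by
        rw [eq_sub_iff_add_eq, tsMk_add, tsMk_inj]; exact ⟨add_zero _, rfl⟩
      rwa [e1]
  obtain ⟨v, hv⟩ := hsep w w' hw hw' hww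
  obtain ⟨a, ha, b, hb, hab⟩ := Submodule.mem_sup.1
    (show tsMk e A B v 0 ∈ S ⊔ S' by rw [hS.sup_eq_top]; trivial)
  obtain ⟨v1, w1, rfl⟩ := exists_tsMk e A B a
  obtain ⟨v2, w2, rfl⟩ := exists_tsMk e A B b
  rw [tsMk_add, tsMk_inj] at hab
  refine hv v1 v2 (hsub _ ?_) (hsub _ ?_) (hsub' _ ?_) (hsub' _ ?_) hab.1
  · rw [← aug1_tsMk e A B v1 w1]; exact S.smul_mem _ ha
  · rw [← aug2_tsMk e A B v1 w1]; exact S.smul_mem _ ha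
  · rw [← aug1_tsMk e A B v2 w2]; exact S'.smul_mem _ hb
  · rw [← aug2_tsMk e A B v2 w2]; exact S'.smul_mem _ hb

end TwoStep

theorem exists_prependZero_add_appendZero (n : ℕ) [NeZero n] (w : Fin (n + 1) → ZMod 2) :
    ∃ v v', w = prependZero n v + appendZero n v' := by
  obtain ⟨k, rfl⟩ := Nat.exists_eq_succ_of_ne_zero (NeZero.ne n)
  have hA : ∀ v, appendZero (k + 1) v = Fin.snoc (α := fun _ => ZMod 2) v 0 := fun _ => rfl
  refine ⟨fun j => w j.succ, Pi.single 0 (w 0), ?_⟩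
  funext j
  refine Fin.cases ?_ (fun j => ?_) j
  · have : appendZero (k + 1) (Pi.single 0 (w 0)) 0 = w 0 := by
      rw [hA, Fin.snoc_apply_zero, Pi.single_eq_same]
    simp [prependZero, this]
  · have : appendZero (k + 1) (Pi.single 0 (w 0)) j.succ = 0 := by
      rw [hA]
      refine Fin.lastCases ?_ (fun j => ?_) j
      · rw [Fin.succ_last, Fin.snoc_last]
      · rw [Fin.succ_castSucc, Fin.snoc_castSucc, Pi.single_eq_of_ne (Fin.succ_ne_zero j)]
    simp [prependZero, this]

theorem isIndecomposable_omegaNeg_one : IsIndecomposable (ZMod 2)[G] (OmegaNeg e 1) := by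
  refine isIndecomposable_of_meet e _ _ ?_ (exists_prependZero_add_appendZero 1)
  decide

/-- For each nonzero v the images under the two shifts span a plane in 𝔽₂³, and two planes there
always share a nonzero vector; `decide` checks this. -/
theorem isIndecomposable_omegaNeg_two : IsIndecomposable (ZMod 2)[G] (OmegaNeg e 2) := by
  refine isIndecomposable_of_meet e _ _ ?_ (exists_prependZero_add_appendZero 2)
  decide

theorem isIndecomposable_omegaPos_one : IsIndecomposable (ZMod 2)[G] (OmegaPos e 1) := by
  refine isIndecomposable_of_fixed e (tsMk e _ _ 0 1) ?_ fun m h1 h2 => ?_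
  · rw [Ne, tsMk_eq_zero]
    exact fun h => one_ne_zero h.2
  · obtain ⟨w, rfl⟩ := omegaPos_fixed e m h1 h2
    have : ∀ w : Fin 1 → ZMod 2, w = 0 ∨ w = 1 := by decide
    rcases this w with rfl | rfl
    · exact Or.inl rfl
    · exact Or.inr rfl

/-- The only nonzero v whose two truncations lie on the line of w = (s, t) is (s, st, t), a point of
the conic (s², st, t²) over 𝔽₂. Neither a point of this conic nor a sum of two distinct ones equals
(0, 1, 0), so two proper summands cannot span. -/
theorem isIndecomposable_omegaPos_two : IsIndecomposable (ZMod 2)[G] (OmegaPos e 2) := by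
  have hW : ∀ w w' u : Fin 2 → ZMod 2, w ≠ 0 ∧ w' ≠ 0 ∧ w ≠ w' →
      u = 0 ∨ u = w ∨ u = w' ∨ u = w + w' := by decide
  have hline : ∀ (w : Fin 2 → ZMod 2) (v : Fin 3 → ZMod 2), w ≠ 0 ∧
      (dropLast 2 v = 0 ∨ dropLast 2 v = w) ∧ (dropFirst 2 v = 0 ∨ dropFirst 2 v = w) →
      v = 0 ∨ v = ![w 0, w 0 * w 1, w 1] := by decide
  have hne : ∀ w w' : Fin 2 → ZMod 2, w ≠ 0 ∧ w' ≠ 0 ∧ w ≠ w' →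
      ![w 0, w 0 * w 1, w 1] ≠ ![0, 1, 0] ∧
      ![w 0, w 0 * w 1, w 1] + ![w' 0, w' 0 * w' 1, w' 1] ≠ ![0, 1, 0] := by decide
  refine isIndecomposable_of_separated e _ _ (fun v h1 h2 => ?_)
    (fun w w' u h h' hww => hW w w' u ⟨h, h', hww⟩) (fun w w' h h' hww => ⟨![0, 1, 0], ?_⟩)
  · funext j
    fin_cases j
    exacts [congrFun h1 0, congrFun h1 1, congrFun h2 1]
  · intro v1 v2 k1 k2 k1' k2'
    rcases hline w v1 ⟨h, k1, k2⟩ with rfl | rfl <;>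
      rcases hline w' v2 ⟨h', k1', k2'⟩ with rfl | rfl
    · decide
    · rw [zero_add]; exact (hne w' w ⟨h', h, hww.symm⟩).1
    · rw [add_zero]; exact (hne w w' ⟨h, h', hww⟩).1
    · exact (hne w w' ⟨h, h', hww⟩).2

end Indecomposable

/-! ### Square classes: signs of involutions and Hilbert 90. -/

section SquareClassField
variable {F K : Type*} [Field F] [Field K] [Algebra F K]

/-- The action of an automorphism on the units. -/
def act (g : K ≃ₐ[F] K) : Kˣ →* Kˣ := Units.map (g : K →* K)

@[simp] theorem coe_act (g : K ≃ₐ[F] K) (u : Kˣ) : (act g u : K) = g u := rfl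

@[simp] theorem act_neg (g : K ≃ₐ[F] K) (u : Kˣ) : act g (-u) = -act g u :=
  Units.ext (by simp)

theorem act_mul (g h : K ≃ₐ[F] K) (u : Kˣ) : act (g * h) u = act g (act h u) := rfl

@[simp] theorem act_one (u : Kˣ) : act (1 : K ≃ₐ[F] K) u = u := rfl

variable (F) in
/-- The class of a unit in `J(K)`. -/
def cls (u : Kˣ) : JMod F K :=
  (rhoJ F K).asModuleEquiv.symm
    (Additive.ofMul (u : Kˣ ⧸ (powMonoidHom 2 : Kˣ →* Kˣ).range))

theorem exists_cls (m : JMod F K) : ∃ u, m = cls F u := by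
  obtain ⟨u, hu⟩ := QuotientGroup.mk_surjective (s := (powMonoidHom 2 : Kˣ →* Kˣ).range)
    (Additive.toMul ((rhoJ F K).asModuleEquiv m))
  exact ⟨u, by rw [cls, hu]; rfl⟩

theorem cls_mul (u v : Kˣ) : cls F (u * v) = cls F u + cls F v := rfl

theorem cls_eq_zero_iff {u : Kˣ} : cls F u = 0 ↔ ∃ t, u = t ^ 2 := by
  change ((u : Kˣ ⧸ (powMonoidHom 2 : Kˣ →* Kˣ).range) = 1) ↔ _
  rw [QuotientGroup.eq_one_iff]
  exact ⟨fun ⟨t, ht⟩ => ⟨t, ht.symm⟩, fun ⟨t, ht⟩ => ⟨t, ht.symm⟩⟩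

theorem cls_sq (t : Kˣ) : cls F (t ^ 2) = 0 := cls_eq_zero_iff.2 ⟨t, rfl⟩

theorem cls_eq_iff {u v : Kˣ} : cls F u = cls F v ↔ ∃ t, v = u * t ^ 2 := by
  constructor
  · intro h
    have : cls F (u * v) = 0 := by rw [cls_mul, h, ← cls_mul, ← sq, cls_sq]
    obtain ⟨t, ht⟩ := cls_eq_zero_iff.1 this
    refine ⟨t / u, ?_⟩
    rw [div_pow, ← ht, sq, mul_div_mul_left_eq_div, mul_div_cancel]
  · rintro ⟨t, rfl⟩
    rw [cls_mul, cls_sq, add_zero]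

theorem of_smul_cls (g : K ≃ₐ[F] K) (u : Kˣ) :
    MonoidAlgebra.of (ZMod 2) (K ≃ₐ[F] K) g • cls F u = cls F (act g u) :=
  of_smul_asModule (rhoJ F K) g _

theorem sq_eq_sq_units {a b : Kˣ} (h : a ^ 2 = b ^ 2) : a = b ∨ a = -b := by
  have : (a : K) ^ 2 = (b : K) ^ 2 := by exact_mod_cast congrArg Units.val h
  rcases sq_eq_sq_iff_eq_or_eq_neg.1 this with h | h
  · exact Or.inl (Units.ext h)
  · exact Or.inr (Units.ext (by simpa using h))

/-- The sign depends only on the square class: s t' = ± t · g s, and applying x ↦ x · g x removes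
the ambiguity, after which s · g s cancels. -/
theorem sign_eq {g : K ≃ₐ[F] K} (hg : g * g = 1) {u s t t' : Kˣ} (ht : act g u = u * t ^ 2)
    (ht' : act g (u * s ^ 2) = u * s ^ 2 * t' ^ 2) : t' * act g t' = t * act g t := by
  have hgg : ∀ u : Kˣ, act g (act g u) = u := fun u => by rw [← act_mul, hg, act_one]
  have h1 : (s * t') ^ 2 = (t * act g s) ^ 2 := by
    rw [map_mul, map_pow, ht] at ht'
    rw [mul_pow, mul_pow]
    apply mul_left_cancel (a := u)
    rw [← mul_assoc, ← ht', mul_assoc]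
  have h2 : (s * t') * act g (s * t') = (t * act g s) * act g (t * act g s) := by
    rcases sq_eq_sq_units h1 with h | h <;> rw [h]
    rw [act_neg, neg_mul_neg]
  simp only [map_mul, hgg] at h2
  apply mul_left_cancel (a := s * act g s)
  calc s * act g s * (t' * act g t') = s * t' * (act g s * act g t') := by ac_rfl
    _ = t * act g s * (act g t * s) := h2
    _ = s * act g s * (t * act g t) := by ac_rfl

theorem sign_cases {g : K ≃ₐ[F] K} (hg : g * g = 1) {u t : Kˣ} (ht : act g u = u * t ^ 2) :
    t * act g t = 1 ∨ t * act g t = -1 := by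
  have h : act g (act g u) = u := by rw [← act_mul, hg, act_one]
  rw [ht, map_mul, map_pow, ht] at h
  refine sq_eq_sq_units ?_
  rw [one_pow, mul_pow]
  apply mul_left_cancel (a := u)
  rw [← mul_assoc, h, mul_one]

theorem one_ne_neg_one_units (h2 : (2 : K) ≠ 0) : (1 : Kˣ) ≠ -1 := by
  intro h
  have h' : (1 : K) = -1 := by simpa using congrArg Units.val h
  apply h2
  rw [← one_add_one_eq_two]
  nth_rw 2 [h']
  exact add_neg_cancel _

/-- For an involution `g`, the functional on `g`-fixed square classes sending the class of `u`,
where `g u = u t²`, to the sign `t · g t`. -/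
theorem exists_sign (h2 : (2 : K) ≠ 0) (g : K ≃ₐ[F] K) (hg : g * g = 1) :
    ∃ T : JMod F K →ₗ[ZMod 2] ZMod 2, ∀ u t, act g u = u * t ^ 2 →
      (t * act g t = 1 → T (cls F u) = 0) ∧ (t * act g t = -1 → T (cls F u) = 1) := by
  classical
  let S : Submodule (ZMod 2) (JMod F K) := LinearMap.ker
    (actMap (JMod F K) (MonoidAlgebra.of (ZMod 2) (K ≃ₐ[F] K) g - 1))
  have hS : ∀ u, cls F u ∈ S ↔ ∃ t, act g u = u * t ^ 2 := by
    intro u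
    rw [← cls_eq_iff (F := F), LinearMap.mem_ker, actMap_apply, sub_smul, one_smul, of_smul_cls,
      sub_eq_zero, eq_comm]
  let P : JMod F K → Prop := fun m =>
    ∃ u t, m = cls F u ∧ act g u = u * t ^ 2 ∧ t * act g t = -1
  have hP : ∀ u t, act g u = u * t ^ 2 → (P (cls F u) ↔ t * act g t = -1) := by
    intro u t ht
    refine ⟨?_, fun h => ⟨u, t, rfl, ht, h⟩⟩
    rintro ⟨u', t', h, ht', hs⟩
    obtain ⟨s, rfl⟩ := cls_eq_iff.1 h
    rw [← sign_eq hg ht ht', hs]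
  have hne := one_ne_neg_one_units h2
  let T0 : S →+ ZMod 2 := AddMonoidHom.mk' (fun m => if P m then 1 else 0) (by
    rintro ⟨m, hm⟩ ⟨m', hm'⟩
    obtain ⟨u, rfl⟩ := exists_cls m
    obtain ⟨u', rfl⟩ := exists_cls m'
    obtain ⟨t, ht⟩ := (hS u).1 hm
    obtain ⟨t', ht'⟩ := (hS u').1 hm'
    have htt : act g (u * u') = u * u' * (t * t') ^ 2 := by
      rw [map_mul, ht, ht', mul_pow, mul_mul_mul_comm]
    have hprod : t * t' * act g (t * t') = (t * act g t) * (t' * act g t') := by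
      rw [map_mul, mul_mul_mul_comm]
    simp only [Submodule.coe_add, ← cls_mul, hP _ _ ht, hP _ _ ht', hP _ _ htt, hprod]
    rcases sign_cases hg ht with h | h <;> rcases sign_cases hg ht' with h' | h' <;>
      simp only [h, h', mul_one, mul_neg, neg_neg, hne, if_true, if_false] <;> decide)
  -- The extension beyond g-fixed classes is arbitrary; only its values on fixed classes carry
  -- meaning.
  obtain ⟨T, hT⟩ := LinearMap.exists_extend (T0.toZModLinearMap 2)
  refine ⟨T, fun u t ht => ?_⟩
  have hu : T (cls F u) = if P (cls F u) then 1 else 0 :=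
    LinearMap.congr_fun hT ⟨cls F u, (hS u).2 ⟨t, ht⟩⟩
  rw [hu, hP u t ht]
  exact ⟨fun h => by rw [h, if_neg hne], fun h => by rw [if_pos h]⟩

/-- Hilbert 90 for an involution, with control over further automorphisms. -/
theorem exists_act_eq_mul (g : K ≃ₐ[F] K) {r u : Kˣ} (hr : act g r = -r)
    (hu : u * act g u = 1) : ∃ v, act g v = u * v ∧
      ∀ h : K ≃ₐ[F] K, act h (act g u) = act g (act h u) → act h u = u → act h r = r →
        act h v = v := by
  have hu' : (u : K) * g u = 1 := by simpa using congrArg Units.val hu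
  -- The solution is v = 1 + g u, since g v = 1 + u = u(g u + 1). It degenerates only for u = -1,
  -- where r serves instead.
  by_cases h1 : (1 : K) + g u = 0
  · have hneg : u = -1 := by
      have h2 : act g u = -1 := Units.ext (by
        rw [coe_act, eq_neg_of_add_eq_zero_right h1]; simp)
      rw [h2, mul_neg, mul_one] at hu
      rw [← hu, neg_neg]
    exact ⟨r, by rw [hr, hneg, neg_one_mul], fun _ _ _ h => h⟩
  · refine ⟨Units.mk0 _ h1, Units.ext ?_, fun h hc hh _ => Units.ext ?_⟩
    · have : g (g (u : K)) = u := by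
        have h3 : g (u : K) * g (g (u : K)) = 1 := by rw [← map_mul, hu', map_one]
        have h4 : g (u : K) ≠ 0 := (act g u).ne_zero
        apply mul_left_cancel₀ h4
        rw [h3, mul_comm, hu']
      simp [this, mul_add, hu', add_comm]
    · have h3 : h (u : K) = u := by simpa using congrArg Units.val hh
      have h4 : h (g (u : K)) = g (h (u : K)) := by simpa using congrArg Units.val hc
      simp [h4, h3]

/-- By Dedekind independence the operator (1 - s)(1 + t) is not zero on K, and each nonzero value
has the required signs. These units play the part of the square roots generating K over F. -/
theorem exists_eigenvector (s t : K ≃ₐ[F] K) (hs : s * s = 1) (ht : t * t = 1)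
    (hst : t * s = s * t) (hinj : Function.Injective ![1, s, t, s * t]) :
    ∃ r : Kˣ, act s r = -r ∧ act t r = r := by
  have hli := (linearIndependent_monoidHom K K).comp
    (fun i : Fin 4 => ((![1, s, t, s * t] i : K ≃ₐ[F] K) : K →* K)) (fun i j hij =>
      hinj (AlgEquiv.ext fun z => DFunLike.congr_fun hij z))
  have hne : ∃ z, z - s z + t z - s (t z) ≠ 0 := by
    by_contra! h
    have := Fintype.linearIndependent_iff.1 hli ![1, -1, 1, -1] (by
      funext z
      simp only [Fin.sum_univ_four, Function.comp]
      simpa [sub_eq_add_neg] using h z) 0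
    simp at this
  obtain ⟨z, hz⟩ := hne
  have hss : ∀ z, s (s z) = z := fun z => AlgEquiv.congr_fun hs z
  have htt : ∀ z, t (t z) = z := fun z => AlgEquiv.congr_fun ht z
  have hts : ∀ z, t (s z) = s (t z) := fun z => AlgEquiv.congr_fun hst z
  refine ⟨Units.mk0 _ hz, Units.ext ?_, Units.ext ?_⟩
  · simp [hss]; ring
  · simp [htt, hts]; ring

end SquareClassField

/-! ### Classes from the base field and norm relations between them. -/

section Biquadratic
variable {F K : Type*} [Field F] [Field K] [Algebra F K]
  (e : (K ≃ₐ[F] K) ≃* Multiplicative (ZMod 2 × ZMod 2))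

theorem aug1_cls (u : Kˣ) : aug1 e • cls F u = cls F (u * act (sigma1 e) u) := by
  rw [aug1, add_smul, one_smul, of_smul_cls, cls_mul]

theorem aug2_cls (u : Kˣ) : aug2 e • cls F u = cls F (u * act (sigma2 e) u) := by
  rw [aug2, add_smul, one_smul, of_smul_cls, cls_mul]

theorem act_sigma1_self (u : Kˣ) : act (sigma1 e) (act (sigma1 e) u) = u := by
  rw [← act_mul, sigma1_mul_self, act_one]

theorem act_sigma2_self (u : Kˣ) : act (sigma2 e) (act (sigma2 e) u) = u := by
  rw [← act_mul, sigma2_mul_self, act_one]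

theorem act_sigma2_sigma1 (u : Kˣ) :
    act (sigma2 e) (act (sigma1 e) u) = act (sigma1 e) (act (sigma2 e) u) := by
  rw [← act_mul, sigma1_mul_sigma2, act_mul]

/-- The square classes of the elements of the base field. -/
def baseClasses : Submodule (ZMod 2) (JMod F K) :=
  AddSubgroup.toZModSubmodule 2
    { carrier := {m | ∃ u : Kˣ, m = cls F u ∧ act (sigma1 e) u = u ∧ act (sigma2 e) u = u}
      zero_mem' := ⟨1, rfl, map_one _, map_one _⟩
      add_mem' := by
        rintro _ _ ⟨u, rfl, h1, h2⟩ ⟨v, rfl, k1, k2⟩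
        exact ⟨u * v, rfl, by rw [map_mul, h1, k1], by rw [map_mul, h2, k2]⟩
      neg_mem' := by
        rintro _ ⟨u, rfl, h1, h2⟩
        exact ⟨u, ZModModule.neg_eq_self _, h1, h2⟩ }

variable {e}

theorem mem_baseClasses {m : JMod F K} : m ∈ baseClasses e ↔
    ∃ u : Kˣ, m = cls F u ∧ act (sigma1 e) u = u ∧ act (sigma2 e) u = u := Iff.rfl

theorem aug1_baseClasses (m : JMod F K) (hm : m ∈ baseClasses e) : aug1 e • m = 0 := by
  obtain ⟨u, rfl, h1, -⟩ := mem_baseClasses.1 hm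
  rw [aug1_cls, h1, ← sq, cls_sq]

theorem aug2_baseClasses (m : JMod F K) (hm : m ∈ baseClasses e) : aug2 e • m = 0 := by
  obtain ⟨u, rfl, -, h2⟩ := mem_baseClasses.1 hm
  rw [aug2_cls, h2, ← sq, cls_sq]

theorem aug1_aug2_mem_baseClasses (m : JMod F K) : aug1 e • aug2 e • m ∈ baseClasses e := by
  obtain ⟨u, rfl⟩ := exists_cls m
  rw [aug2_cls, aug1_cls]
  refine mem_baseClasses.2 ⟨_, rfl, ?_, ?_⟩
  · rw [map_mul, act_sigma1_self, mul_comm]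
  · simp only [map_mul, act_sigma2_sigma1, act_sigma2_self]
    ac_rfl

/-- Write the partial norms of γ as f₁s² and f₂t² with s fixed by σ₁ and t by σ₂. Computing the norm
of γ to F both ways gives (f₁ · s σ₂s)² = (f₂ · t σ₁t)², so f₁ and f₂ differ by norms from the
intermediate fields and a sign. -/
theorem exists_sub_norm {r1 r2 : Kˣ} (hr1 : act (sigma1 e) r1 = -r1) (hr1' : act (sigma2 e) r1 = r1)
    (hr2 : act (sigma1 e) r2 = r2) (hr2' : act (sigma2 e) r2 = -r2) (m : JMod F K)
    (h1 : aug1 e • m ∈ baseClasses e) (h2 : aug2 e • m ∈ baseClasses e) :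
    ∃ c ∈ norms1 e (baseClasses e), ∃ d ∈ norms2 e (baseClasses e),
      aug1 e • m + c = aug2 e • m + d := by
  obtain ⟨γ, rfl⟩ := exists_cls m
  have red1 : ∃ f s : Kˣ, act (sigma1 e) f = f ∧ act (sigma2 e) f = f ∧ act (sigma1 e) s = s ∧
      γ * act (sigma1 e) γ = f * s ^ 2 := by
    obtain ⟨f, hf, k1, k2⟩ := mem_baseClasses.1 h1
    rw [aug1_cls] at hf
    obtain ⟨s, hs⟩ := cls_eq_iff.1 hf.symm
    have hs2 : (act (sigma1 e) s) ^ 2 = s ^ 2 := by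
      apply mul_left_cancel (a := f)
      rw [← hs, ← map_pow]
      nth_rw 1 [← k1]
      rw [← map_mul, ← hs, map_mul, act_sigma1_self, mul_comm]
    rcases sq_eq_sq_units hs2 with h | h
    · exact ⟨f, s, k1, k2, h, hs⟩
    -- If σ₁ negates s, dividing by r1 makes it fixed, and r1² is still fixed by both generators.
    · refine ⟨f * r1 ^ 2, s / r1, ?_, ?_, ?_, ?_⟩
      · rw [map_mul, k1, map_pow, hr1, neg_sq]
      · rw [map_mul, k2, map_pow, hr1']
      · rw [map_div, h, hr1, neg_div_neg_eq]
      · rw [hs, mul_assoc, ← mul_pow, mul_div_cancel]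
  have red2 : ∃ f s : Kˣ, act (sigma1 e) f = f ∧ act (sigma2 e) f = f ∧ act (sigma2 e) s = s ∧
      γ * act (sigma2 e) γ = f * s ^ 2 := by
    obtain ⟨f, hf, k1, k2⟩ := mem_baseClasses.1 h2
    rw [aug2_cls] at hf
    obtain ⟨s, hs⟩ := cls_eq_iff.1 hf.symm
    have hs2 : (act (sigma2 e) s) ^ 2 = s ^ 2 := by
      apply mul_left_cancel (a := f)
      rw [← hs, ← map_pow]
      nth_rw 1 [← k2]
      rw [← map_mul, ← hs, map_mul, act_sigma2_self, mul_comm]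
    rcases sq_eq_sq_units hs2 with h | h
    · exact ⟨f, s, k1, k2, h, hs⟩
    · refine ⟨f * r2 ^ 2, s / r2, ?_, ?_, ?_, ?_⟩
      · rw [map_mul, k1, map_pow, hr2]
      · rw [map_mul, k2, map_pow, hr2', neg_sq]
      · rw [map_div, h, hr2', neg_div_neg_eq]
      · rw [hs, mul_assoc, ← mul_pow, mul_div_cancel]
  obtain ⟨f1, s, k1, k2, k3, hs⟩ := red1
  obtain ⟨f2, t, j1, j2, j3, ht⟩ := red2
  have hd : cls F (s * act (sigma2 e) s) ∈ norms2 e (baseClasses e) := mem_norms2.2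
    ⟨mem_baseClasses.2 ⟨_, rfl, by rw [map_mul, k3, ← act_sigma2_sigma1, k3],
      by rw [map_mul, act_sigma2_self, mul_comm]⟩, cls F s, by rw [aug1_cls, k3, ← sq, cls_sq],
      aug2_cls e s⟩
  have hc : cls F (t * act (sigma1 e) t) ∈ norms1 e (baseClasses e) := mem_norms1.2
    ⟨mem_baseClasses.2 ⟨_, rfl, by rw [map_mul, act_sigma1_self, mul_comm],
      by rw [map_mul, j3, act_sigma2_sigma1, j3]⟩, cls F t, aug1_cls e t,
      by rw [aug2_cls, j3, ← sq, cls_sq]⟩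
  -- The stray sign is harmless: r1 · σ₁r1 = -r1², so the class of -1 is itself a norm.
  have hm1 : cls F (-1 : Kˣ) ∈ norms1 e (baseClasses e) := mem_norms1.2
    ⟨mem_baseClasses.2 ⟨_, rfl, by rw [act_neg, map_one], by rw [act_neg, map_one]⟩, cls F r1,
      by rw [aug1_cls, hr1, mul_neg, ← neg_one_mul, ← sq, cls_mul, cls_sq, add_zero],
      by rw [aug2_cls, hr1', ← sq, cls_sq]⟩
  have hnorm : (f1 * (s * act (sigma2 e) s)) ^ 2 = (f2 * (t * act (sigma1 e) t)) ^ 2 := by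
    have n1 : γ * act (sigma1 e) γ * act (sigma2 e) (γ * act (sigma1 e) γ)
        = (f1 * (s * act (sigma2 e) s)) ^ 2 := by
      rw [hs, map_mul, map_pow, k2, mul_mul_mul_comm, mul_pow, mul_pow, sq f1]
    have n2 : γ * act (sigma2 e) γ * act (sigma1 e) (γ * act (sigma2 e) γ)
        = (f2 * (t * act (sigma1 e) t)) ^ 2 := by
      rw [ht, map_mul, map_pow, j1, mul_mul_mul_comm, mul_pow, mul_pow, sq f2]
    rw [← n1, ← n2, map_mul, map_mul, act_sigma2_sigma1, mul_mul_mul_comm]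
  have a1 : aug1 e • cls F γ = cls F f1 := by rw [aug1_cls, hs, cls_mul, cls_sq, add_zero]
  have a2 : aug2 e • cls F γ = cls F f2 := by rw [aug2_cls, ht, cls_mul, cls_sq, add_zero]
  have two : ∀ m : JMod F K, m + m = 0 := add_self_of_groupAlgebra (K ≃ₐ[F] K)
  rw [a1, a2]
  have fin : ∀ a b c d : JMod F K, a + d = b + c → a + c = b + d := by
    intro a b c d h
    calc a + c = a + d + (d + c) := by
          rw [show a + d + (d + c) = a + (d + d) + c by abel, two, add_zero]
      _ = b + d := by rw [h, show b + c + (d + c) = b + d + (c + c) by abel, two, add_zero]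
  rcases sq_eq_sq_units hnorm with h | h
  · refine ⟨_, hc, _, hd, fin _ _ _ _ ?_⟩
    rw [← cls_mul, h, cls_mul]
  · refine ⟨_, Submodule.add_mem _ hm1 hc, _, hd, fin _ _ _ _ ?_⟩
    rw [← cls_mul, h, ← neg_one_mul, cls_mul, cls_mul]
    abel

end Biquadratic

/-! ### Signs of fixed classes. -/

section Biquadratic
variable {F K : Type*} [Field F] [Field K] [Algebra F K]
  {e : (K ≃ₐ[F] K) ≃* Multiplicative (ZMod 2 × ZMod 2)}

/-- `T` computes the sign of `g` on square classes fixed by `g`. -/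
def IsSign (g : K ≃ₐ[F] K) (T : JMod F K →ₗ[ZMod 2] ZMod 2) : Prop :=
  ∀ u t, act g u = u * t ^ 2 →
    (t * act g t = 1 → T (cls F u) = 0) ∧ (t * act g t = -1 → T (cls F u) = 1)

theorem IsSign.eq_one {g : K ≃ₐ[F] K} {T : JMod F K →ₗ[ZMod 2] ZMod 2} (hT : IsSign g T)
    (hg : g * g = 1) {u t : Kˣ} (ht : act g u = u * t ^ 2) (h0 : T (cls F u) = 0) :
    t * act g t = 1 :=
  (sign_cases hg ht).resolve_right fun h => zero_ne_one (h0.symm.trans ((hT u t ht).2 h))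

theorem IsSign.eq_zero {g : K ≃ₐ[F] K} {T : JMod F K →ₗ[ZMod 2] ZMod 2} (hT : IsSign g T)
    {u : Kˣ} (hu : act g u = u) : T (cls F u) = 0 :=
  (hT u 1 (by rw [hu, one_pow, mul_one])).1 (by rw [map_one, mul_one])

/-- The sign of a partial norm whose norm is the square of `s`. -/
theorem IsSign.norm {g : K ≃ₐ[F] K} {T : JMod F K →ₗ[ZMod 2] ZMod 2} (hT : IsSign g T)
    {u s : Kˣ} (hu : u * act g u = s ^ 2) :
    (act g s = s → T (cls F u) = 0) ∧ (act g s = -s → T (cls F u) = 1) := by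
  have ht : act g u = u * (s / u) ^ 2 := by
    rw [div_pow, ← hu, sq u, mul_div_mul_left_eq_div, mul_div_cancel]
  have hs : s / u * act g (s / u) = s * act g s / s ^ 2 := by
    rw [map_div, div_mul_div_comm, hu]
  constructor
  · intro h
    refine (hT u _ ht).1 ?_
    rw [hs, h, ← sq, div_self']
  · intro h
    refine (hT u _ ht).2 ?_
    rw [hs, h, mul_neg, ← sq, neg_div, div_self']

/-- Conversely to the easy direction, Hilbert 90 for σ₂ gives a σ₂-fixed representative δ, and
Hilbert 90 for σ₁ then makes it σ₁-fixed. The third sign ensures that this second correction does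
not disturb σ₂-invariance. -/
theorem mem_baseClasses_iff {T0 T1 T2 : JMod F K →ₗ[ZMod 2] ZMod 2}
    (h0 : IsSign (sigma2 e) T0) (h1 : IsSign (sigma1 e) T1) (h2 : IsSign (sigma1 e * sigma2 e) T2)
    (hne : (1 : Kˣ) ≠ -1)
    {r1 r2 : Kˣ} (hr1 : act (sigma1 e) r1 = -r1) (hr1' : act (sigma2 e) r1 = r1)
    (hr2' : act (sigma2 e) r2 = -r2) (m : JMod F K)
    (hm1 : aug1 e • m = 0) (hm2 : aug2 e • m = 0) :
    m ∈ baseClasses e ↔ T0 m = 0 ∧ T1 m = 0 ∧ T2 m = 0 := by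
  constructor
  · intro hm
    obtain ⟨u, rfl, k1, k2⟩ := mem_baseClasses.1 hm
    exact ⟨h0.eq_zero k2, h1.eq_zero k1, h2.eq_zero (by rw [act_mul, k2, k1])⟩
  · rintro ⟨z0, z1, z2⟩
    rw [← of_sigma1_smul_iff] at hm1
    rw [← of_sigma2_smul_iff] at hm2
    obtain ⟨γ, rfl⟩ := exists_cls m
    rw [of_smul_cls] at hm1 hm2
    obtain ⟨t, ht⟩ := cls_eq_iff.1 hm2.symm
    obtain ⟨v, hv, -⟩ := exists_act_eq_mul (sigma2 e) hr2'
      (h0.eq_one (sigma2_mul_self e) ht z0)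
    have hδ : cls F (γ / v ^ 2) = cls F γ :=
      cls_eq_iff.2 ⟨v, by rw [div_mul_cancel]⟩
    have hδ2 : act (sigma2 e) (γ / v ^ 2) = γ / v ^ 2 := by
      rw [map_div, map_pow, ht, hv, mul_pow, mul_comm γ, mul_div_mul_left_eq_div]
    rw [← hδ] at z1 z2 hm1 ⊢
    generalize γ / v ^ 2 = δ at *
    have hm1' : cls F (act (sigma1 e) δ) = cls F δ := by
      rw [← of_smul_cls, hδ, of_smul_cls, hm1, hδ]
    obtain ⟨t1, ht1⟩ := cls_eq_iff.1 hm1'.symm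
    have k1 := h1.eq_one (sigma1_mul_self e) ht1 z1
    have k2 := h2.eq_one (sigma12_mul_self e) (t := t1)
      (by rw [act_mul, hδ2, ht1]) z2
    have hsq : (act (sigma2 e) t1) ^ 2 = t1 ^ 2 := by
      apply mul_left_cancel (a := δ)
      rw [← ht1, ← map_pow]
      nth_rw 1 [← hδ2]
      rw [← map_mul, ← ht1, act_sigma2_sigma1, hδ2]
    -- As δ is fixed by σ₂, the same t1 computes the signs for σ₁ and σ₁σ₂. If σ₂ negated t1, these
    -- two signs would be opposite.
    have hfix : act (sigma2 e) t1 = t1 := by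
      refine (sq_eq_sq_units hsq).resolve_right fun h => hne ?_
      rw [act_mul, h, act_neg, mul_neg, k1] at k2
      exact k2.symm
    obtain ⟨w, hw, hw'⟩ := exists_act_eq_mul (sigma1 e) hr1 k1
    refine mem_baseClasses.2 ⟨δ / w ^ 2, (cls_eq_iff.2 ⟨w, by rw [div_mul_cancel]⟩).symm, ?_, ?_⟩
    · rw [map_div, map_pow, ht1, hw, mul_pow, mul_comm δ, mul_div_mul_left_eq_div]
    · rw [map_div, map_pow, hδ2, hw' _ (act_sigma2_sigma1 e t1) hfix hr1']

/-- The hypothesis says that the norm of γ to F is a square s². All the mixed signs can then be read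
off from σ₁s = ±s and σ₂s = ±s, and the sign for σ₁σ₂ is the product of the two. -/
theorem sign_relations {T0 T1 T2 : JMod F K →ₗ[ZMod 2] ZMod 2}
    (h0 : IsSign (sigma2 e) T0) (h1 : IsSign (sigma1 e) T1) (h2 : IsSign (sigma1 e * sigma2 e) T2)
    (m : JMod F K) (hm : aug1 e • aug2 e • m = 0) :
    T1 (aug1 e • m) = 0 ∧ T0 (aug2 e • m) = 0 ∧
      T2 (aug1 e • m) = T0 (aug1 e • m) + T1 (aug2 e • m) ∧
      T2 (aug2 e • m) = T0 (aug1 e • m) + T1 (aug2 e • m) := by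
  obtain ⟨γ, rfl⟩ := exists_cls m
  rw [aug2_cls, aug1_cls] at hm
  obtain ⟨s, hs⟩ := cls_eq_zero_iff.1 hm
  rw [aug1_cls, aug2_cls]
  have f1 : act (sigma1 e) (γ * act (sigma1 e) γ) = γ * act (sigma1 e) γ := by
    rw [map_mul, act_sigma1_self, mul_comm]
  have f2 : act (sigma2 e) (γ * act (sigma2 e) γ) = γ * act (sigma2 e) γ := by
    rw [map_mul, act_sigma2_self, mul_comm]
  have n1 : γ * act (sigma1 e) γ * act (sigma2 e) (γ * act (sigma1 e) γ) = s ^ 2 := by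
    rw [← hs, map_mul, map_mul, act_sigma2_sigma1, mul_mul_mul_comm]
  have s1 : act (sigma1 e) (s ^ 2) = s ^ 2 := by
    rw [← hs, map_mul, act_sigma1_self, mul_comm]
  have s2 : act (sigma2 e) (s ^ 2) = s ^ 2 := by
    rw [← n1, map_mul, act_sigma2_self, mul_comm]
  have c0 := h0.norm n1
  have c1 := h1.norm hs
  have c2 := h2.norm (u := γ * act (sigma1 e) γ) (s := s)
    (by rw [act_mul, ← act_sigma2_sigma1, f1, n1])
  have c2' := h2.norm (u := γ * act (sigma2 e) γ) (s := s) (by rw [act_mul, f2, hs])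
  rw [map_pow] at s1 s2
  refine ⟨h1.eq_zero f1, h0.eq_zero f2, ?_⟩
  rcases sq_eq_sq_units s1 with e1 | e1 <;> rcases sq_eq_sq_units s2 with e2 | e2
  · rw [c0.1 e2, c1.1 e1]
    have : act (sigma1 e * sigma2 e) s = s := by rw [act_mul, e2, e1]
    exact ⟨c2.1 this, c2'.1 this⟩
  · rw [c0.2 e2, c1.1 e1]
    have : act (sigma1 e * sigma2 e) s = -s := by rw [act_mul, e2, act_neg, e1]
    exact ⟨c2.2 this, c2'.2 this⟩
  · rw [c0.1 e2, c1.2 e1]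
    have : act (sigma1 e * sigma2 e) s = -s := by rw [act_mul, e2, e1]
    exact ⟨c2.2 this, c2'.2 this⟩
  · rw [c0.2 e2, c1.2 e1]
    have : act (sigma1 e * sigma2 e) s = s := by rw [act_mul, e2, act_neg, e1, neg_neg]
    exact ⟨c2.1 this, c2'.1 this⟩

end Biquadratic

theorem injective_klein {G : Type*} [Group G] (e : G ≃* Multiplicative (ZMod 2 × ZMod 2)) :
    Function.Injective ![1, sigma1 e, sigma2 e, sigma1 e * sigma2 e] ∧
      Function.Injective ![1, sigma2 e, sigma1 e, sigma2 e * sigma1 e] := by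
  have h1 := sigma1_ne_one e
  have h2 := sigma2_ne_one e
  have h12 := sigma12_ne_one e
  have hne := sigma1_ne_sigma2 e
  rw [sigma1_mul_sigma2]
  constructor <;> intro i j hij <;> fin_cases i <;> fin_cases j <;>
    simp_all [eq_comm (a := (1 : G))]

end BiquadraticModule
end

theorem theorem1 {F K : Type*} [Field F] [Field K] [Algebra F K] [IsGalois F K]
    (hchar : ringChar K ≠ 2)
    (e : (K ≃ₐ[F] K) ≃* Multiplicative (ZMod 2 × ZMod 2)) :
    -- the decomposition `J(K) = X ⊕ Y₀ ⊕ ⋯ ⊕ Y₄ ⊕ Z₁ ⊕ Z₂`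
    (∃ (X : Submodule (ZMod 2)[K ≃ₐ[F] K] (BiquadraticModule.JMod F K))
       (Y : Fin 5 → Submodule (ZMod 2)[K ≃ₐ[F] K] (BiquadraticModule.JMod F K))
       (Z : Fin 2 → Submodule (ZMod 2)[K ≃ₐ[F] K] (BiquadraticModule.JMod F K)),
      DirectSum.IsInternal (Sum.elim (fun _ : Unit => X) (Sum.elim Y Z)) ∧
      (X = ⊥ ∨
        Nonempty (X ≃ₗ[(ZMod 2)[K ≃ₐ[F] K]] BiquadraticModule.TrivMod (K ≃ₐ[F] K)) ∨
        Nonempty (X ≃ₗ[(ZMod 2)[K ≃ₐ[F] K]]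
          BiquadraticModule.TrivMod (K ≃ₐ[F] K) × BiquadraticModule.TrivMod (K ≃ₐ[F] K)) ∨
        Nonempty (X ≃ₗ[(ZMod 2)[K ≃ₐ[F] K]] BiquadraticModule.OmegaNeg e 1) ∨
        Nonempty (X ≃ₗ[(ZMod 2)[K ≃ₐ[F] K]] BiquadraticModule.OmegaNeg e 2) ∨
        Nonempty (X ≃ₗ[(ZMod 2)[K ≃ₐ[F] K]]
          BiquadraticModule.OmegaNeg e 1 × BiquadraticModule.OmegaNeg e 1)) ∧
      (∀ i : Fin 5, BiquadraticModule.IsSumOfCopies (ZMod 2)[K ≃ₐ[F] K]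
        (BiquadraticModule.PermMod e i) (Y i)) ∧
      BiquadraticModule.IsSumOfCopies (ZMod 2)[K ≃ₐ[F] K]
        (BiquadraticModule.OmegaPos e 1) (Z 0) ∧
      BiquadraticModule.IsSumOfCopies (ZMod 2)[K ≃ₐ[F] K]
        (BiquadraticModule.OmegaPos e 2) (Z 1)) ∧
    -- the nine modules that can occur as summands are indecomposable
    (∀ i : Fin 5, BiquadraticModule.IsIndecomposable (ZMod 2)[K ≃ₐ[F] K]
      (BiquadraticModule.PermMod e i)) ∧
    BiquadraticModule.IsIndecomposable (ZMod 2)[K ≃ₐ[F] K] (BiquadraticModule.OmegaNeg e 1) ∧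
    BiquadraticModule.IsIndecomposable (ZMod 2)[K ≃ₐ[F] K] (BiquadraticModule.OmegaNeg e 2) ∧
    BiquadraticModule.IsIndecomposable (ZMod 2)[K ≃ₐ[F] K] (BiquadraticModule.OmegaPos e 1) ∧
    BiquadraticModule.IsIndecomposable (ZMod 2)[K ≃ₐ[F] K] (BiquadraticModule.OmegaPos e 2) := by
  open BiquadraticModule in
  refine ⟨?_, isIndecomposable_permMod e, isIndecomposable_omegaNeg_one e,
    isIndecomposable_omegaNeg_two e, isIndecomposable_omegaPos_one e,
    isIndecomposable_omegaPos_two e⟩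
  have two := Ring.two_ne_zero hchar
  obtain ⟨T0, h0⟩ := exists_sign two (sigma2 e) (sigma2_mul_self e)
  obtain ⟨T1, h1⟩ := exists_sign two (sigma1 e) (sigma1_mul_self e)
  obtain ⟨T2, h2⟩ := exists_sign two (sigma1 e * sigma2 e) (sigma12_mul_self e)
  obtain ⟨r1, hr1, hr1'⟩ := exists_eigenvector _ _ (sigma1_mul_self e) (sigma2_mul_self e)
    (sigma1_mul_sigma2 e) (injective_klein e).1
  obtain ⟨r2, hr2, hr2'⟩ := exists_eigenvector _ _ (sigma2_mul_self e) (sigma1_mul_self e)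
    (sigma1_mul_sigma2 e).symm (injective_klein e).2
  obtain ⟨X, Y, Z, hint, hX, hYZ⟩ := exists_decomposition (e := e) (U := baseClasses e)
    ![T0, T1, T2]
    (fun m hm1 hm2 => by
      rw [mem_baseClasses_iff h0 h1 h2 (one_ne_neg_one_units two) hr1 hr1' hr2 m hm1 hm2,
        Fin.forall_fin_succ, Fin.forall_fin_two]
      rfl)
    aug1_baseClasses aug2_baseClasses aug1_aug2_mem_baseClasses (sign_relations h0 h1 h2)
    (exists_sub_norm hr1 hr1' hr2' hr2)
  refine ⟨X, Y, Z, hint, ?_, hYZ⟩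
  -- The alternatives 𝔽₂ and 𝔽₂ ⊕ 𝔽₂ for X never arise here: trivial summands are absorbed into `Y
  -- 4`.
  rcases hX with h | h | h | h
  · exact Or.inl ((Submodule.subsingleton_iff_eq_bot).1 h)
  · exact Or.inr (Or.inr (Or.inr (Or.inl h)))
  · exact Or.inr (Or.inr (Or.inr (Or.inr (Or.inl h))))
  · exact Or.inr (Or.inr (Or.inr (Or.inr (Or.inr h))))
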